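/- Conventions. A \emph{commutative 2-ring} is a symmetric monoidal category $A$ whose underlying category is (locally) presentable and such that $a\otimes -$ and $-\otimes a$ preserve small colimits for every $a\in A$. A \emph{1-morphism} $A\to B$ of commutative 2-rings is an adjunction $f^*\dashv f_*$ with $f^*:A\to B$ equipped with the structure of a (strong) symmetric monoidal functor; a \emph{2-morphism} $f\Rightarrow g$ is a monoidal natural transformation $f^*\Rightarrow g^*$. These form the category $\mathrm{Hom}_{\mathsf{Com2Ring}}(A,B)$. A \emph{commutative $A$-2-algebra} is a commutative 2-ring $B$ together with a 1-morphism $A\to B$ of commutative 2-rings. A 1-morphism of commutative $A$-2-algebras from $f:A\to B$ to $g:A\to C$ is a pair $(h,\zeta)$, where $h:B\to C$ is a 1-morphism of commutative 2-rings and $\zeta:g\Rightarrow h\circ f$ is an invertible 2-morphism; a 2-morphism $(h,\zeta)\Rightarrow(h',\zeta')$ is a 2-morphism $\xi:h\Rightarrow h'$ such that $\zeta'$ equals $\zeta$ followed by the whiskering of $\xi$ by $f$. These form the category $\mathrm{Hom}_{A\text{-}\mathsf{Com2Alg}}(B,C)$. Lemma. Let $G$ be a small category and $A$ a commutative 2-ring.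 Write ${}^GA=\mathrm{Fun}(G,A)$ with the pointwise tensor product, and ${}^G\mathsf{Set}=\mathrm{Fun}(G,\mathsf{Set})$ with the pointwise cartesian product as tensor product. Then ${}^GA$ is a commutative 2-ring, and the functor $A\to{}^GA$ sending $a$ to the constant functor at $a$, with its evident symmetric monoidal structure, has a right adjoint and so makes ${}^GA$ a commutative $A$-2-algebra. Moreover, regarding $A$ as an $A$-2-algebra through its identity, there is an equivalence of categories \[ \mathrm{TK}(G,A)=\mathrm{Hom}_{A\text{-}\mathsf{Com2Alg}}({}^GA,A)\;\simeq\;\mathrm{Hom}_{\mathsf{Com2Ring}}({}^G\mathsf{Set},A). \] -/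

import Mathlib

open CategoryTheory MonoidalCategory Limits

universe v u u₁ u₂ u₃

set_option linter.unusedSectionVars false

noncomputable section

/-- A commutative 2-ring: a symmetric monoidal category which is (locally) presentable and whose
tensor product preserves small colimits in each variable. Small means `v`-small, where `v` is the
universe of the morphisms. -/
class ComTwoRing (A : Type u) [Category.{v} A] [MonoidalCategory A] [SymmetricCategory A] :
    Prop where
  presentable : IsLocallyPresentable.{v} A
  cocontinuous_left (a : A) : PreservesColimitsOfSize.{v, v} (tensorLeft a)
  cocontinuous_right (a : A) : PreservesColimitsOfSize.{v, v} (tensorRight a)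

namespace ComTwoRing

section Morphisms

variable (A : Type u₁) [Category.{v} A] [MonoidalCategory A] [SymmetricCategory A] [ComTwoRing A]
variable (B : Type u₂) [Category.{v} B] [MonoidalCategory B] [SymmetricCategory B] [ComTwoRing B]
variable (C : Type u₃) [Category.{v} C] [MonoidalCategory C] [SymmetricCategory C] [ComTwoRing C]

/-- A 1-morphism of commutative 2-rings `A → B`: a left adjoint functor `A ⥤ B` together with its
right adjoint, where the left adjoint carries the structure of a (strong) symmetric monoidal
functor. -/
structure Hom where
  left : A ⥤ B
  right : B ⥤ A
  adj : left ⊣ right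
  braided : left.Braided

attribute [instance] Hom.braided

variable {A B C}

namespace Hom

/-- A 2-morphism between 1-morphisms of commutative 2-rings: a monoidal natural transformation
between the left adjoints. -/
@[ext]
structure Trans (f g : Hom A B) where
  nat : f.left ⟶ g.left
  isMonoidal : NatTrans.IsMonoidal nat

attribute [instance] Trans.isMonoidal

/-- The category of 1-morphisms of commutative 2-rings from `A` to `B`. -/
instance category : Category (Hom A B) where
  Hom f g := Trans f g
  id f := ⟨𝟙 f.left, inferInstance⟩
  comp s t := ⟨s.nat ≫ t.nat, inferInstance⟩
  id_comp _ := Trans.ext (Category.id_comp _)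
  comp_id _ := Trans.ext (Category.comp_id _)
  assoc _ _ _ := Trans.ext (Category.assoc _ _ _)

variable (A) in
/-- The identity 1-morphism. -/
def idHom : Hom A A where
  left := 𝟭 A
  right := 𝟭 A
  adj := Adjunction.id
  braided := inferInstance

/-- The composite of 1-morphisms, `f` first and `h` second. -/
def comp (f : Hom A B) (h : Hom B C) : Hom A C where
  left := f.left ⋙ h.left
  right := h.right ⋙ f.right
  adj := f.adj.comp h.adj
  braided := inferInstance

/-- Whiskering of a 2-morphism `h ⇒ h'` by a 1-morphism `f`. -/
def whisker (f : Hom A B) {h h' : Hom B C} (ξ : h ⟶ h') : f.comp h ⟶ f.comp h' :=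
  (⟨Functor.whiskerLeft f.left (Trans.nat ξ),
    haveI := Trans.isMonoidal ξ
    inferInstanceAs (NatTrans.IsMonoidal (Functor.whiskerLeft f.left (Trans.nat ξ)))⟩ :
    Trans (f.comp h) (f.comp h'))

theorem whisker_id (f : Hom A B) (h : Hom B C) : f.whisker (𝟙 h) = 𝟙 (f.comp h) :=
  Trans.ext (Functor.whiskerLeft_id _)

theorem whisker_comp (f : Hom A B) {h h' h'' : Hom B C} (ξ : h ⟶ h') (ξ' : h' ⟶ h'') :
    f.whisker (ξ ≫ ξ') = f.whisker ξ ≫ f.whisker ξ' :=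
  Trans.ext (Functor.whiskerLeft_comp _ _ _)

end Hom

/-- A commutative `A`-2-algebra structure on the commutative 2-ring `B`: a 1-morphism of
commutative 2-rings `A → B`. -/
abbrev AlgebraStr (A : Type u₁) [Category.{v} A] [MonoidalCategory A] [SymmetricCategory A]
    [ComTwoRing A] (B : Type u₂) [Category.{v} B] [MonoidalCategory B] [SymmetricCategory B]
    [ComTwoRing B] :=
  Hom A B

/-- A 1-morphism of commutative `A`-2-algebras from `f : A → B` to `g : A → C`: a 1-morphism
`h : B → C` of commutative 2-rings with an invertible 2-morphism `ζ : g ⇒ h ∘ f`. -/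
structure AlgHom (f : AlgebraStr A B) (g : AlgebraStr A C) where
  hom : Hom B C
  ζ : g ≅ Hom.comp f hom

namespace AlgHom

variable {f : AlgebraStr A B} {g : AlgebraStr A C}

/-- A 2-morphism `(h, ζ) ⇒ (h', ζ')` of commutative `A`-2-algebras: a 2-morphism `ξ : h ⇒ h'` of
commutative 2-rings such that `ζ'` is `ζ` followed by the whiskering of `ξ` by `f`. -/
@[ext]
structure Trans (φ ψ : AlgHom f g) where
  trans : φ.hom ⟶ ψ.hom
  w : φ.ζ.hom ≫ Hom.whisker f trans = ψ.ζ.hom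

/-- The category of 1-morphisms of commutative `A`-2-algebras from `f : A → B` to
`g : A → C`. -/
instance category : Category (AlgHom f g) where
  Hom φ ψ := Trans φ ψ
  id φ := ⟨𝟙 φ.hom, by rw [Hom.whisker_id, Category.comp_id]⟩
  comp s t := ⟨s.trans ≫ t.trans, by rw [Hom.whisker_comp, ← Category.assoc, s.w, t.w]⟩
  id_comp _ := Trans.ext (Category.id_comp _)
  comp_id _ := Trans.ext (Category.comp_id _)
  assoc _ _ _ := Trans.ext (Category.assoc _ _ _)

end AlgHom

end Morphisms

/-- The constant-functor functor `A ⥤ (G ⥤ A)` is symmetric monoidal for the pointwise tensor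
product on `G ⥤ A`; all the comparison maps are identities. -/
instance constBraided (G : Type v) [SmallCategory G] (A : Type u) [Category.{v} A]
    [MonoidalCategory A] [SymmetricCategory A] : (Functor.const G : A ⥤ G ⥤ A).Braided where
  ε := { app := fun _ => 𝟙 _ }
  μ := fun X Y => { app := fun _ => 𝟙 (X ⊗ Y) }
  η := { app := fun _ => 𝟙 _ }
  δ := fun X Y => { app := fun _ => 𝟙 (X ⊗ Y) }
  braided X Y := by
    ext g
    exact (Category.id_comp _).trans (Category.comp_id _).symm

/-- The commutative `A`-2-algebra structure on `G ⥤ A` (with its pointwise tensor product) given by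
the constant functors, with a right adjoint `L` of `A ⥤ (G ⥤ A)`. -/
def constAlgebra (G : Type v) [SmallCategory G] (A : Type u) [Category.{v} A] [MonoidalCategory A]
    [SymmetricCategory A] [ComTwoRing A] [ComTwoRing (G ⥤ A)] {L : (G ⥤ A) ⥤ A}
    (adj : (Functor.const G : A ⥤ G ⥤ A) ⊣ L) : AlgebraStr A (G ⥤ A) where
  left := Functor.const G
  right := L
  adj := adj
  braided := constBraided G A

/-- `G ⥤ Set`, with the pointwise cartesian product as tensor product, is a commutative 2-ring. -/
instance functorType (G : Type v) [SmallCategory G] : ComTwoRing (G ⥤ Type v) where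
  presentable :=
    ((opOpEquivalence G).congrLeft (E := Type v)).isLocallyPresentable
  cocontinuous_left F := by
    infer_instance
  cocontinuous_right F := by
    have := preservesColimits_of_natIso (BraidedCategory.tensorLeftIsoTensorRight F)
    infer_instance

/-- The Tannaka–Krein category: the category of 1-morphisms of commutative `A`-2-algebras
`(G ⥤ A) → A`, where `G ⥤ A` is the `A`-2-algebra of `constAlgebra` and `A` is an `A`-2-algebra by
its identity. -/
abbrev TannakaKrein (G : Type v) [SmallCategory G] (A : Type u) [Category.{v} A]
    [MonoidalCategory A] [SymmetricCategory A] [ComTwoRing A] [ComTwoRing (G ⥤ A)]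
    {L : (G ⥤ A) ⥤ A} (adj : (Functor.const G : A ⥤ G ⥤ A) ⊣ L) :=
  AlgHom (constAlgebra G A adj) (Hom.idHom A)

end ComTwoRing

end

/-! Morally `G ⥤ A` is the tensor product of the 2-rings `A` and `G ⥤ Type v`. Constant functors and
pointwise copowers of the unit map these two into `G ⥤ A` by cocontinuous symmetric monoidal
functors. The products of a constant functor and a copower generate under colimits: with the copower
taken of a corepresentable functor they are the values of `free A g`, left adjoint to evaluation at
`g`. An algebra morphism `(G ⥤ A) → A` is prescribed on constants up to isomorphism, so only its
restriction along `copowerHom` remains to be chosen, and `restriction` is the equivalence.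

Fully faithful: on such a product a monoidal transformation is forced by its values on the two
factors, whence uniqueness (`eq_of_generators`). For existence, the forced values on free functors
are glued along a canonical presentation of each functor (`exists_extension`). Compatibility with
all tensor products follows from `TensorRelation.of_generators`, which reduces it to the pairs
constant-constant, copower-copower and constant-copower.

Essentially surjective: `F` extends to the coend `M ↦ ∫^g M g ⊗ F(G(g,-))`. Diagonals make
set-valued functors cocommutative comonoids, hence also their images under `F`, and this makes the
coend oplax symmetric monoidal. A co-Yoneda argument (`coendComparison_isIso`) computes it on the
product of the constant at `a` and the copowers of `X` as `a ⊗ F X`. So it restricts to the identity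
on `A` and to `F`, and `of_generators` shows that it is strong monoidal. Right adjoints come from
the adjoint functor theorem. -/

set_option linter.unusedSectionVars false

noncomputable section

namespace ComTwoRing

/-! ### The adjoint functor theorem for locally presentable categories -/

section AdjointFunctorTheorem

/-- For a cocontinuous functor on a category with a small generator under colimits, every object
of the target is covered by a single universal arrow from the image (up to uniqueness). -/
theorem exists_weakly_terminal_costructuredArrow {A : Type u} [Category.{v} A]
    [HasColimitsOfSize.{v, v} A] {D : Type u₁} [Category.{v} D] (F : A ⥤ D)
    [PreservesColimitsOfSize.{v, v} F] (P : ObjectProperty A) [ObjectProperty.Small.{v} P]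
    (hP : ∀ X : A, ∃ (J : Type v) (_ : SmallCategory J), P.colimitsOfShape J X) (d : D) :
    ∃ (T : A) (t : F.obj T ⟶ d), ∀ (X : A) (x : F.obj X ⟶ d), ∃ g : X ⟶ T, F.map g ≫ t = x := by
  have : EssentiallySmall.{v} P.FullSubcategory := essentiallySmall_of_small_of_locallySmall _
  -- `T` will be the colimit of all generators over `d`; this index category is essentially small,
  -- so the colimit exists and `F` preserves it.
  let I := CostructuredArrow (P.ι ⋙ F) d
  let pr : I ⥤ A := CostructuredArrow.proj (P.ι ⋙ F) d ⋙ P.ι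
  have : HasColimitsOfShape I A :=
    hasColimitsOfShape_of_equivalence (equivSmallModel.{v} I).symm
  have : PreservesColimitsOfShape I F :=
    preservesColimitsOfShape_of_equiv (equivSmallModel.{v} I).symm F
  let hc := isColimitOfPreserves F (colimit.isColimit pr)
  let c : Cocone (pr ⋙ F) :=
    { pt := d
      ι := { app := fun i => i.hom, naturality := fun i j f =>
              (CostructuredArrow.w f).trans (Category.comp_id _).symm } }
  refine ⟨colimit pr, hc.desc c, fun X x => ?_⟩
  obtain ⟨J, _, ⟨p⟩⟩ := hP X
  -- Write `X` as a colimit of generators: each leg followed by `x` is itself an object of `I`, so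
  -- the legs of the big colimit assemble to a map `X ⟶ T`.
  let e (j : J) : I := CostructuredArrow.mk (S := P.ι ⋙ F) (Y := ⟨p.diag.obj j, p.prop_diag_obj j⟩)
    (F.map (p.ι.app j) ≫ x)
  let s : Cocone p.diag :=
    { pt := colimit pr
      ι :=
        { app := fun j => colimit.ι pr (e j)
          naturality := fun j k f => by
            let φ : e j ⟶ e k := CostructuredArrow.homMk (ObjectProperty.homMk (p.diag.map f)) (by
              change F.map (p.diag.map f) ≫ F.map (p.ι.app k) ≫ x = F.map (p.ι.app j) ≫ x
              rw [← F.map_comp_assoc, p.ι.naturality]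
              simp)
            exact (colimit.w pr φ).trans (Category.comp_id _).symm } }
  refine ⟨p.isColimit.desc s, (isColimitOfPreserves F p.isColimit).hom_ext fun j => ?_⟩
  change F.map (p.ι.app j) ≫ F.map (p.isColimit.desc s) ≫ hc.desc c = F.map (p.ι.app j) ≫ x
  have h1 : p.ι.app j ≫ p.isColimit.desc s = colimit.ι pr (e j) := p.isColimit.fac s j
  rw [← F.map_comp_assoc, h1]
  exact hc.fac c (e j)

/-- Adjoint functor theorem: a cocontinuous functor out of a locally presentable category is a left
adjoint. -/
theorem isLeftAdjoint_of_isLocallyPresentable {A : Type u} [Category.{v} A]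
    [IsLocallyPresentable.{v} A] {D : Type u₁} [Category.{v} D] (F : A ⥤ D)
    [PreservesColimitsOfSize.{v, v} F] : F.IsLeftAdjoint := by
  obtain ⟨κ, _, _⟩ := IsLocallyPresentable.exists_cardinal.{v} A
  obtain ⟨P, _, hP⟩ := HasCardinalFilteredGenerator.exists_small_generator A κ
  have : HasColimitsOfSize.{v, v} A := inferInstance
  have : HasLimits Aᵒᵖ := hasLimits_op_of_hasColimits
  have : PreservesLimitsOfSize.{v, v} F.op := preservesLimitsOfSize_op F
  have key : F.op.IsRightAdjoint := by
    -- Freyd's criterion for `F.op`, with the single object `T` as solution set.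
    refine isRightAdjoint_of_preservesLimits_of_solutionSetCondition F.op fun d => ?_
    obtain ⟨T, t, ht⟩ := exists_weakly_terminal_costructuredArrow F P (fun X => by
      obtain ⟨J, i, _, h⟩ := hP.exists_colimitsOfShape X
      exact ⟨J, i, h⟩) d.unop
    refine ⟨PUnit, fun _ => Opposite.op T, fun _ => t.op, fun X x => ?_⟩
    obtain ⟨g, hg⟩ := ht X.unop x.unop
    exact ⟨⟨⟩, g.op, Quiver.Hom.unop_inj hg⟩
  exact ⟨_, ⟨(Adjunction.ofIsRightAdjoint F.op).unop⟩⟩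

/-- Limits of shape `J` amount to a right adjoint of the constant-diagram functor, which is
cocontinuous because colimits of diagrams are pointwise. -/
theorem hasLimits_of_isLocallyPresentable (A : Type u) [Category.{v} A]
    [IsLocallyPresentable.{v} A] : HasLimits A where
  has_limits_of_shape J _ := by
    obtain ⟨κ, _, _⟩ := IsLocallyPresentable.exists_cardinal.{v} A
    exact hasLimitsOfShape_iff_isLeftAdjoint_const.2 (isLeftAdjoint_of_isLocallyPresentable _)

end AdjointFunctorTheorem

/-! ### Functor categories as commutative 2-rings -/

section FunctorCategory

variable (A : Type u) [Category.{v} A] [MonoidalCategory A] [SymmetricCategory A] [ComTwoRing A]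

instance (priority := 100) hasColimits : HasColimitsOfSize.{v, v} A := by
  obtain ⟨κ, _, _⟩ := (ComTwoRing.presentable (A := A)).exists_cardinal
  infer_instance

variable {A} in
instance preservesColimits_tensorLeft (a : A) : PreservesColimitsOfSize.{v, v} (tensorLeft a) :=
  cocontinuous_left a

variable {A} in
instance preservesColimits_tensorRight (a : A) : PreservesColimitsOfSize.{v, v} (tensorRight a) :=
  cocontinuous_right a

instance preservesColimits_tensorLeft_functor {J : Type u₁} [Category.{u₂} J] (M : J ⥤ A) :
    PreservesColimitsOfSize.{v, v} (tensorLeft M) :=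
  ⟨fun {_} _ => ⟨fun {D} => preservesColimit_of_evaluation _ _ fun j =>
    inferInstanceAs (PreservesColimit D ((evaluation J A).obj j ⋙ tensorLeft (M.obj j)))⟩⟩

instance preservesColimits_tensorRight_functor {J : Type u₁} [Category.{u₂} J] (M : J ⥤ A) :
    PreservesColimitsOfSize.{v, v} (tensorRight M) :=
  ⟨fun {_} _ => ⟨fun {D} => preservesColimit_of_evaluation _ _ fun j =>
    inferInstanceAs (PreservesColimit D ((evaluation J A).obj j ⋙ tensorRight (M.obj j)))⟩⟩

/-- Functor categories with values in a commutative 2-ring are commutative 2-rings. -/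
theorem functorCategory (G : Type v) [SmallCategory G] : ComTwoRing (G ⥤ A) where
  presentable := by
    have := ComTwoRing.presentable (A := A)
    have := hasLimits_of_isLocallyPresentable A
    -- Transport from presheaves on `Gᵒᵖ`.
    exact ((opOpEquivalence G).congrLeft (E := A)).isLocallyPresentable
  cocontinuous_left _ := inferInstance
  cocontinuous_right _ := inferInstance

theorem isLeftAdjoint_const (G : Type v) [SmallCategory G] :
    (Functor.const G : A ⥤ G ⥤ A).IsLeftAdjoint :=
  have := ComTwoRing.presentable (A := A)
  isLeftAdjoint_of_isLocallyPresentable _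

end FunctorCategory


/-! ### Copowers of the unit as a symmetric monoidal functor -/

section Copower

variable (A : Type u) [Category.{v} A] [MonoidalCategory A] [SymmetricCategory A] [ComTwoRing A]

/-- The functor `Type v ⥤ A` sending a set `S` to the `S`-fold copower of the tensor unit. -/
def copower : Type v ⥤ A := sigmaConst.obj (𝟙_ A)

/-- The copower functor is left adjoint to `Hom(𝟙_ A, -)`. -/
def copowerAdj : copower A ⊣ coyoneda.obj (Opposite.op (𝟙_ A)) := sigmaConstAdj (𝟙_ A)

/-- The oplax monoidal structure on the copower functor, mate of the lax monoidal structure of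
`Hom(𝟙_ A, -)`. -/
@[reducible]
def copowerOplaxMonoidal : (copower A).OplaxMonoidal := (copowerAdj A).leftAdjointOplaxMonoidal

variable {A}

/-- The coprojection of the copower at an element. -/
def point {S : Type v} (s : S) : 𝟙_ A ⟶ (copower A).obj S := Sigma.ι (fun _ : S => 𝟙_ A) s

@[simp]
theorem point_map {S T : Type v} (s : S) (f : S ⟶ T) :
    point s ≫ (copower A).map f = point (A := A) (f s) := by
  simp [point, copower]

theorem copower_hom_ext {S : Type v} {b : A} {f g : (copower A).obj S ⟶ b}
    (h : ∀ s : S, point s ≫ f = point s ≫ g) : f = g :=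
  Sigma.hom_ext _ _ h

theorem point_homEquiv_symm {S : Type v} (s : S) {b : A}
    (f : S ⟶ (coyoneda.obj (Opposite.op (𝟙_ A))).obj b) :
    point s ≫ ((copowerAdj A).homEquiv S b).symm f = f s := by
  rw [Adjunction.homEquiv_counit, reassoc_of% @point_map]
  exact Sigma.ι_desc (f := fun _ : 𝟙_ A ⟶ b => 𝟙_ A) _ _

/-- The inclusion of `a` in the copower `a ⊗ copower S` at an element of `S`. -/
def incl (a : A) {S : Type v} (s : S) : a ⟶ a ⊗ (copower A).obj S := (ρ_ a).inv ≫ a ◁ point s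

@[simp]
theorem incl_map (a : A) {S T : Type v} (s : S) (f : S ⟶ T) :
    incl a s ≫ a ◁ (copower A).map f = incl a (f s) := by
  simp [incl, ← MonoidalCategory.whiskerLeft_comp]

theorem incl_whiskerRight {a b : A} (f : a ⟶ b) {S : Type v} (s : S) :
    incl a s ≫ f ▷ (copower A).obj S = f ≫ incl b s := by
  simp [incl, whisker_exchange]

/-- `a ⊗ copower S` is an `S`-fold copower of `a`. -/
def isColimitIncl (a : A) (S : Type v) :
    IsColimit (Cofan.mk (a ⊗ (copower A).obj S) fun s : S => incl a s) := by
  let e : Cofan.mk (a ⊗ (copower A).obj S) (fun s : S => a ◁ point (A := A) s) ≅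
      Cofan.mk (f := fun _ : S => a ⊗ 𝟙_ A) (a ⊗ (copower A).obj S)
        (fun s : S => a ◁ point (A := A) s) := Iso.refl _
  -- Tensoring with `a` preserves the coproduct of units; the right unitor then turns the summands
  -- `a ⊗ 𝟙_ A` into `a`.
  have h : IsColimit (Cofan.mk (f := fun _ : S => a ⊗ 𝟙_ A) (a ⊗ (copower A).obj S)
      (fun s : S => a ◁ point (A := A) s)) :=
    isColimitCofanMkObjOfIsColimit (tensorLeft a) (fun _ : S => 𝟙_ A) _
      (coproductIsCoproduct fun _ : S => 𝟙_ A)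
  refine Cofan.IsColimit.mk _ (fun t => Cofan.IsColimit.desc h fun s => (ρ_ a).hom ≫ t.inj s) ?_ ?_
  · intro t s
    simp only [Cofan.mk_pt, incl, cofan_mk_inj, Category.assoc]
    rw [Iso.inv_comp_eq]
    exact Cofan.IsColimit.fac h _ s
  · intro t m hm
    refine Cofan.IsColimit.hom_ext h _ _ fun s => ?_
    rw [Cofan.IsColimit.fac, ← hm s]
    simp [incl, Cofan.inj]

theorem incl_hom_ext {a b : A} {S : Type v} {f g : a ⊗ (copower A).obj S ⟶ b}
    (h : ∀ s : S, incl a s ≫ f = incl a s ≫ g) : f = g :=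
  Cofan.IsColimit.hom_ext (isColimitIncl a S) _ _ h

/-- The morphism out of `a ⊗ copower S` given by a family of morphisms out of `a`. -/
def inclDesc {a b : A} {S : Type v} (f : S → (a ⟶ b)) : a ⊗ (copower A).obj S ⟶ b :=
  Cofan.IsColimit.desc (isColimitIncl a S) f

@[simp]
theorem incl_desc {a b : A} {S : Type v} (f : S → (a ⟶ b)) (s : S) :
    incl a s ≫ inclDesc f = f s :=
  Cofan.IsColimit.fac (isColimitIncl a S) f s

/-- Links the two descriptions of a summand of `copower S ⊗ copower T`: iterated copower, and tensor
product of points. It is what inverts `δ`. -/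
theorem point_comp_incl {S T : Type v} (s : S) (t : T) :
    point s ≫ incl ((copower A).obj S) t = (λ_ (𝟙_ A)).inv ≫ (point s ⊗ₘ point t) := by
  rw [incl, rightUnitor_inv_naturality_assoc, MonoidalCategory.tensorHom_def, unitors_inv_equal]

section

attribute [local instance] copowerOplaxMonoidal

theorem point_oplaxMonoidal_η (s : 𝟙_ (Type v)) :
    point s ≫ Functor.OplaxMonoidal.η (copower A) = 𝟙 (𝟙_ A) :=
  point_homEquiv_symm _ _

theorem point_oplaxMonoidal_δ {S T : Type v} (s : S) (t : T) :
    point (S := S ⊗ T) (s, t) ≫ Functor.OplaxMonoidal.δ (copower A) S T =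
      (λ_ (𝟙_ A)).inv ≫ (point s ⊗ₘ point t) :=
  point_homEquiv_symm _ _

instance : IsIso (Functor.OplaxMonoidal.η (copower A)) :=
  ⟨point PUnit.unit, copower_hom_ext fun s => by
    rw [← Category.assoc, point_oplaxMonoidal_η, Category.id_comp, Category.comp_id]; rfl,
    point_oplaxMonoidal_η _⟩

/-- The tensor product distributes over copowers, so both sides are copowers of the unit indexed by
pairs. The inverse is built by fixing `t` first. -/
instance (S T : Type v) : IsIso (Functor.OplaxMonoidal.δ (copower A) S T) := by
  refine ⟨inclDesc fun t => (copower A).map (↾fun s => (s, t)), copower_hom_ext ?_, ?_⟩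
  · rintro ⟨s, t⟩
    rw [← Category.assoc, point_oplaxMonoidal_δ, ← point_comp_incl, Category.assoc, incl_desc,
      point_map, Category.comp_id]
    rfl
  · refine incl_hom_ext fun t => copower_hom_ext fun s => ?_
    rw [reassoc_of% @incl_desc, reassoc_of% @point_map]
    exact (point_oplaxMonoidal_δ s t).trans (by rw [← point_comp_incl, Category.comp_id])

instance : (copower A).Monoidal := Functor.Monoidal.ofOplaxMonoidal _

end

@[simp]
theorem point_η (s : 𝟙_ (Type v)) :
    point s ≫ Functor.OplaxMonoidal.η (copower A) = 𝟙 (𝟙_ A) :=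
  point_oplaxMonoidal_η s

@[simp]
theorem point_δ {S T : Type v} (s : S) (t : T) :
    point (S := S ⊗ T) (s, t) ≫ Functor.OplaxMonoidal.δ (copower A) S T =
      (λ_ (𝟙_ A)).inv ≫ (point s ⊗ₘ point t) :=
  point_oplaxMonoidal_δ s t

instance : (copower A).Braided where
  braided S T := by
    -- With `δ` in place of `μ` both composites start from a copower, so they can be compared on
    -- points `(s, t)`.
    rw [← cancel_epi (Functor.OplaxMonoidal.δ (copower A) S T), Functor.Monoidal.δ_μ_assoc,
      ← cancel_mono (Functor.OplaxMonoidal.δ (copower A) T S)]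
    refine copower_hom_ext ?_
    rintro ⟨s, t⟩
    simp only [Category.assoc, Functor.Monoidal.μ_δ, Category.comp_id, reassoc_of% @point_δ]
    rw [BraidedCategory.braiding_naturality, reassoc_of% @point_map, braiding_tensorUnit_left,
      Category.assoc, Iso.inv_hom_id_assoc, ← unitors_inv_equal]
    exact point_δ t s

end Copower

section FunctorCopower

variable (G : Type v) [SmallCategory G]
variable (A : Type u) [Category.{v} A] [MonoidalCategory A] [SymmetricCategory A] [ComTwoRing A]

/-- Pointwise copowers, as a functor from `G ⥤ Type v` to `G ⥤ A`. -/
abbrev functorCopower : (G ⥤ Type v) ⥤ G ⥤ A :=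
  (Functor.whiskeringRight G (Type v) A).obj (copower A)

instance : (functorCopower G A).Braided where
  braided X Y := by
    ext g
    exact Functor.LaxBraided.braided (F := copower A) (X.obj g) (Y.obj g)

/-- The 1-morphism from `G ⥤ Type v` to `G ⥤ A` given by pointwise copowers. -/
def copowerHom [ComTwoRing (G ⥤ A)] : Hom (G ⥤ Type v) (G ⥤ A) where
  left := functorCopower G A
  right := _
  adj := (copowerAdj A).whiskerRight G
  braided := inferInstance

end FunctorCopower


/-! ### Properties closed under colimits -/

section Closure

variable {C : Type u₁} [Category.{v} C] {D : Type u₂} [Category.{v} D]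

/-- The objects at which two natural transformations agree are closed under colimits. -/
theorem isClosedUnderColimits_app_eq {F F' : C ⥤ D} (σ τ : F ⟶ F')
    [PreservesColimitsOfSize.{v, v} F] (J : Type v) [SmallCategory J] :
    ObjectProperty.IsClosedUnderColimitsOfShape (fun X => σ.app X = τ.app X) J where
  colimitsOfShape_le X := by
    rintro ⟨p⟩
    refine (isColimitOfPreserves F p.isColimit).hom_ext fun j => ?_
    have h : σ.app (p.diag.obj j) = τ.app (p.diag.obj j) := p.prop_diag_obj j
    change F.map (p.ι.app j) ≫ σ.app X = F.map (p.ι.app j) ≫ τ.app X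
    exact (σ.naturality (p.ι.app j)).trans (Eq.trans (by rw [h]) (τ.naturality (p.ι.app j)).symm)

/-- The objects at which a natural transformation of cocontinuous functors is invertible are closed
under colimits. -/
theorem isClosedUnderColimits_isIso_app {F F' : C ⥤ D} (τ : F ⟶ F')
    [PreservesColimitsOfSize.{v, v} F] [PreservesColimitsOfSize.{v, v} F']
    (J : Type v) [SmallCategory J] :
    ObjectProperty.IsClosedUnderColimitsOfShape (fun X => IsIso (τ.app X)) J where
  colimitsOfShape_le X := by
    rintro ⟨p⟩
    have h (j : J) : IsIso (τ.app (p.diag.obj j)) := p.prop_diag_obj j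
    have : IsIso (Functor.whiskerLeft p.diag τ) :=
      (NatTrans.isIso_iff_isIso_app _).2 fun j => h j
    let e := asIso (Functor.whiskerLeft p.diag τ)
    let i := (isColimitOfPreserves F p.isColimit).coconePointsIsoOfNatIso
      (isColimitOfPreserves F' p.isColimit) e
    -- The component at the colimit is the map induced by the invertible components on the diagram.
    have hi : τ.app X = i.hom := by
      refine (isColimitOfPreserves F p.isColimit).hom_ext fun j => ?_
      refine Eq.trans ?_
        (IsColimit.comp_coconePointsIsoOfNatIso_hom _
          (isColimitOfPreserves F' p.isColimit) e j).symm
      exact τ.naturality (p.ι.app j)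
    change IsIso (τ.app X)
    rw [hi]
    infer_instance

end Closure

/-! ### Presenting functors by left adjoints of evaluations -/

section Generation

variable {G : Type v} [SmallCategory G] {C : Type u₁} [Category.{v} C]
variable {L : G → C ⥤ G ⥤ C} (adj : ∀ g, L g ⊣ (evaluation G C).obj g)

/-- The contravariant action of a morphism on the values of the left adjoints of evaluations. -/
def transposeMap {g g' : G} (f : g ⟶ g') (a : C) : (L g').obj a ⟶ (L g).obj a :=
  ((adj g').homEquiv a _).symm ((adj g).unit.app a ≫ ((L g).obj a).map f)

theorem homEquiv_transposeMap_comp {g g' : G} (f : g ⟶ g') {a : C} {N : G ⥤ C}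
    (k : (L g).obj a ⟶ N) :
    (adj g').homEquiv _ _ (transposeMap adj f a ≫ k) = (adj g).homEquiv _ _ k ≫ N.map f := by
  rw [transposeMap, Adjunction.homEquiv_naturality_right, Equiv.apply_symm_apply,
    Adjunction.homEquiv_unit, Category.assoc, Category.assoc]
  exact congrArg _ (k.naturality f)

/-- The counit of the adjunction at `g`, at a functor `M`. -/
def evalCounit (g : G) (M : G ⥤ C) : (L g).obj (M.obj g) ⟶ M := (adj g).counit.app M

theorem evalCounit_naturality (g : G) {M N : G ⥤ C} (m : M ⟶ N) :
    (L g).map (m.app g) ≫ evalCounit adj g N = evalCounit adj g M ≫ m :=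
  (adj g).counit.naturality m

theorem homEquiv_evalCounit (g : G) (M : G ⥤ C) :
    (adj g).homEquiv (M.obj g) M (evalCounit adj g M) = 𝟙 (M.obj g) :=
  ((adj g).homEquiv_apply_eq _ _).2 ((adj g).homEquiv_symm_id M).symm

theorem transposeMap_evalCounit {g g' : G} (f : g ⟶ g') (M : G ⥤ C) :
    transposeMap adj f (M.obj g) ≫ evalCounit adj g M =
      (L g').map (M.map f) ≫ evalCounit adj g' M := by
  apply ((adj g').homEquiv _ _).injective
  rw [homEquiv_transposeMap_comp, Adjunction.homEquiv_naturality_left]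
  exact Eq.trans (congrArg (· ≫ M.map f) (homEquiv_evalCounit adj g M))
    (Eq.trans ((Category.id_comp _).trans (Category.comp_id _).symm)
      (congrArg (M.map f ≫ ·) (homEquiv_evalCounit adj g' M)).symm)

/-- The morphism out of `M : G ⥤ C` glued from morphisms out of its presentation. -/
def presentationDesc {M N : G ⥤ C} (k : ∀ g, (L g).obj (M.obj g) ⟶ N)
    (hk : ∀ {g g' : G} (f : g ⟶ g'),
      transposeMap adj f (M.obj g) ≫ k g = (L g').map (M.map f) ≫ k g') : M ⟶ N where
  app g := (adj g).homEquiv _ _ (k g)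
  naturality g g' f := by
    -- Under the adjunctions, the cofork condition is exactly the naturality square.
    rw [← homEquiv_transposeMap_comp, hk, Adjunction.homEquiv_naturality_left]

theorem evalCounit_comp_eq_iff {M N : G ⥤ C} {g : G} (m : M ⟶ N) (k : (L g).obj (M.obj g) ⟶ N) :
    evalCounit adj g M ≫ m = k ↔ m.app g = (adj g).homEquiv _ _ k := by
  rw [← ((adj g).homEquiv (M.obj g) N).apply_eq_iff_eq, Adjunction.homEquiv_naturality_right]
  exact Eq.congr_left (Eq.trans (congrArg (· ≫ m.app g) (homEquiv_evalCounit adj g M))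
    (Category.id_comp _))

/-- The diagram presenting a functor `G ⥤ C` as a colimit of values of the left adjoints of
evaluations. -/
def presentationIndex (M : G ⥤ C) :
    MultispanIndex (.mk (Σ g g' : G, g ⟶ g') G (fun x => x.1) (fun x => x.2.1)) (G ⥤ C) where
  left x := (L x.2.1).obj (M.obj x.1)
  right g := (L g).obj (M.obj g)
  fst x := transposeMap adj x.2.2 (M.obj x.1)
  snd x := (L x.2.1).map (M.map x.2.2)

/-- The cofork presenting a functor `G ⥤ C`. -/
def presentation (M : G ⥤ C) : Multicofork (presentationIndex adj M) :=
  Multicofork.ofπ _ M (fun g => evalCounit adj g M) fun x => transposeMap_evalCounit adj x.2.2 M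

/-- Every functor `G ⥤ C` is the colimit of its presentation. -/
def isColimitPresentation (M : G ⥤ C) : IsColimit (presentation adj M) :=
  Multicofork.IsColimit.mk _
    (fun E => presentationDesc adj E.π fun {g g'} f => E.condition ⟨g, g', f⟩)
    (fun _ _ => (evalCounit_comp_eq_iff adj _ _).2 rfl)
    (fun _ _ hm => by
      ext g
      exact (evalCounit_comp_eq_iff adj _ _).1 (hm g))

section Preserves

variable {D : Type u₂} [Category.{v} D] (F : (G ⥤ C) ⥤ D) [PreservesColimitsOfSize.{v, v} F]

theorem map_evalCounit_hom_ext {M : G ⥤ C} {d : D} {m m' : F.obj M ⟶ d}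
    (h : ∀ g, F.map (evalCounit adj g M) ≫ m = F.map (evalCounit adj g M) ≫ m') : m = m' :=
  Multicofork.IsColimit.hom_ext
    (Multicofork.isColimitMapOfPreserves _ F (isColimitPresentation adj M)) h

theorem exists_map_evalCounit_comp {M : G ⥤ C} {d : D} (k : ∀ g, F.obj ((L g).obj (M.obj g)) ⟶ d)
    (hk : ∀ {g g' : G} (f : g ⟶ g'),
      F.map (transposeMap adj f (M.obj g)) ≫ k g = F.map ((L g').map (M.map f)) ≫ k g') :
    ∃ m : F.obj M ⟶ d, ∀ g, F.map (evalCounit adj g M) ≫ m = k g :=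
  ⟨_, fun g => Multicofork.IsColimit.fac
    (Multicofork.isColimitMapOfPreserves _ F (isColimitPresentation adj M)) k
    (fun x => hk x.2.2) g⟩

end Preserves

/-- A property of functors `G ⥤ C` closed under colimits holds for all functors if it holds for
the values of the left adjoints of evaluations. -/
theorem prop_of_leftAdjoint_evaluation {L : G → C ⥤ G ⥤ C}
    (adj : ∀ g, L g ⊣ (evaluation G C).obj g) (P : ObjectProperty (G ⥤ C))
    (hP : ∀ (J : Type v) [SmallCategory J], P.IsClosedUnderColimitsOfShape J)
    (h : ∀ g a, P ((L g).obj a)) (M : G ⥤ C) : P M := by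
  have := hP (WalkingMultispan (.mk (Σ g g' : G, g ⟶ g') G (fun x => x.1) (fun x => x.2.1)))
  exact P.prop_of_isColimit (isColimitPresentation adj M) (by rintro (x | g) <;> exact h _ _)

/-- A property of functors `G ⥤ Type v` closed under colimits holds for all functors if it holds
for the representable ones. -/
theorem prop_of_coyoneda (P : ObjectProperty (G ⥤ Type v))
    (hP : ∀ (J : Type v) [SmallCategory J], P.IsClosedUnderColimitsOfShape J)
    (h : ∀ g, P (coyoneda.obj (Opposite.op g))) (X : G ⥤ Type v) : P X := by
  refine prop_of_leftAdjoint_evaluation (fun g => evaluationAdjunctionRight (Type v) g) P hP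
    (fun g S => ?_) X
  have := hP (Discrete S)
  -- An isomorphism exhibits its target as a one-term coproduct of its source.
  have : P.IsClosedUnderIsomorphisms := ⟨fun {X Y} e hX => by
    have := hP (Discrete PUnit)
    exact P.prop_of_isColimit (c := Cofan.mk Y fun _ : PUnit => e.hom)
      (Cofan.IsColimit.mk _ (fun t => e.inv ≫ t.inj ⟨⟩) (by simp)
        (fun t m hm => by simp [← hm ⟨⟩])) (fun _ => hX)⟩
  let i : (evaluationLeftAdjoint (Type v) g).obj PUnit ≅ coyoneda.obj (Opposite.op g) :=
    NatIso.ofComponents (fun k =>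
      { hom := Sigma.desc fun f => ↾fun _ => f
        inv := ↾fun f => Sigma.ι (fun _ : g ⟶ k => PUnit.{v + 1}) f PUnit.unit
        hom_inv_id := by
          refine Sigma.hom_ext _ _ fun f => ?_
          exact (Sigma.ι_desc_assoc (fun f : g ⟶ k => (↾fun _ => f : PUnit.{v + 1} ⟶ (g ⟶ k))) f
            _).trans (Category.comp_id _).symm
        inv_hom_id := by
          ext f
          exact ConcreteCategory.congr_hom
            (Sigma.ι_desc (fun f : g ⟶ k => (↾fun _ => f : PUnit.{v + 1} ⟶ (g ⟶ k))) f)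
            PUnit.unit }) (fun {k k'} f => by
          refine Sigma.hom_ext _ _ fun f' => ?_
          refine ((Sigma.ι_desc_assoc _ f' _).trans
            (Sigma.ι_desc (fun f : g ⟶ k' => (↾fun _ => f : PUnit.{v + 1} ⟶ (g ⟶ k'))) _)).trans ?_
          refine Eq.trans ?_ (Sigma.ι_desc_assoc
            (fun f : g ⟶ k => (↾fun _ => f : PUnit.{v + 1} ⟶ (g ⟶ k))) f'
            ((coyoneda.obj (Opposite.op g)).map f)).symm
          rfl)
  -- `S` is a coproduct of points, and the left adjoint sends a point to a corepresentable functor.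
  let c : Cofan fun _ : S => PUnit.{v + 1} := Cofan.mk S fun s => ↾fun _ => s
  let hc : IsColimit c := Cofan.IsColimit.mk _ (fun t => ↾fun s => t.inj s PUnit.unit)
    (fun t s => rfl) (fun t m hm => by
      ext s
      exact congrArg (fun q => q PUnit.unit) (hm s))
  have := (evaluationAdjunctionRight (Type v) g).leftAdjoint_preservesColimits
  exact P.prop_of_isColimit (isColimitOfPreserves (evaluationLeftAdjoint (Type v) g) hc)
    (fun _ => P.prop_of_iso i.symm (h g))

end Generation


/-! ### Free functors as products of constants and copowers -/

section Generators

variable (G : Type v) [SmallCategory G]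
variable (A : Type u) [Category.{v} A] [MonoidalCategory A] [SymmetricCategory A] [ComTwoRing A]

variable {G} in
/-- The functor sending `a` to the copowers of `a` by the functor corepresented by `g`. -/
def free (g : G) : A ⥤ G ⥤ A :=
  Functor.const G ⋙ tensorRight ((functorCopower G A).obj (coyoneda.obj (Opposite.op g)))

variable {G A}

/-- The inclusion of `a` in the value of `free g` indexed by a morphism out of `g`. -/
def freeIncl (a : A) {g k : G} (u : g ⟶ k) : a ⟶ ((free A g).obj a).obj k :=
  incl a (S := g ⟶ k) u

theorem freeIncl_map (a : A) {g k l : G} (u : g ⟶ k) (w : k ⟶ l) :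
    freeIncl a u ≫ ((free A g).obj a).map w = freeIncl a (u ≫ w) := by
  refine Eq.trans ?_
    (incl_map a (S := g ⟶ k) (T := g ⟶ l) u ((coyoneda.obj (Opposite.op g)).map w))
  dsimp [free, freeIncl]
  rw [id_tensorHom]

theorem freeIncl_free_map {a b : A} (f : a ⟶ b) {g k : G} (u : g ⟶ k) :
    freeIncl a u ≫ ((free A g).map f).app k = f ≫ freeIncl b u :=
  incl_whiskerRight f (S := g ⟶ k) u

theorem freeIncl_whiskerLeft (a : A) {g g' k : G} (f : g ⟶ g') (u : g' ⟶ k) :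
    freeIncl a u ≫ ((Functor.const G).obj a ◁
      (functorCopower G A).map (coyoneda.map f.op)).app k = freeIncl a (f ≫ u) :=
  incl_map a (S := g' ⟶ k) (T := g ⟶ k) u ((coyoneda.map f.op).app k)

theorem freeIncl_hom_ext {a b : A} {g k : G} {m m' : ((free A g).obj a).obj k ⟶ b}
    (h : ∀ u : g ⟶ k, freeIncl a u ≫ m = freeIncl a u ≫ m') : m = m' :=
  incl_hom_ext (S := g ⟶ k) h

/-- The morphism out of a value of `free g` given by a family of morphisms. -/
def freeInclDesc {a b : A} {g k : G} (f : (g ⟶ k) → (a ⟶ b)) : ((free A g).obj a).obj k ⟶ b :=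
  inclDesc f

theorem freeIncl_desc {a b : A} {g k : G} (f : (g ⟶ k) → (a ⟶ b)) (u : g ⟶ k) :
    freeIncl a u ≫ freeInclDesc f = f u :=
  incl_desc f u

/-- The natural transformation out of `free g` given by a morphism to the value at `g`. -/
def freeDesc {a : A} {N : G ⥤ A} {g : G} (f : a ⟶ N.obj g) : (free A g).obj a ⟶ N where
  app k := freeInclDesc fun u => f ≫ N.map u
  naturality k l w := freeIncl_hom_ext fun u => by
    rw [reassoc_of% @freeIncl_map, freeIncl_desc, reassoc_of% @freeIncl_desc, Category.assoc,
      N.map_comp]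

theorem freeIncl_freeDesc_app {a : A} {N : G ⥤ A} {g : G} (f : a ⟶ N.obj g) {k : G} (u : g ⟶ k) :
    freeIncl a u ≫ (freeDesc f).app k = f ≫ N.map u :=
  freeIncl_desc _ u

/-- Yoneda: naturality carries the summand at `𝟙 g` to the summand at any `u`. -/
theorem free_hom_ext {a : A} {N : G ⥤ A} {g : G} {m m' : (free A g).obj a ⟶ N}
    (h : freeIncl a (𝟙 g) ≫ m.app g = freeIncl a (𝟙 g) ≫ m'.app g) : m = m' := by
  ext k
  refine freeIncl_hom_ext fun u => ?_
  rw [← Category.id_comp u, ← freeIncl_map, Category.assoc, Category.assoc, m.naturality,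
    m'.naturality, reassoc_of% h]

variable (A) in
/-- `free g` is left adjoint to the evaluation at `g`. -/
def freeAdj (g : G) : free A g ⊣ (evaluation G A).obj g :=
  Adjunction.mkOfHomEquiv
    { homEquiv a N :=
        { toFun f := freeIncl a (𝟙 g) ≫ f.app g
          invFun f := freeDesc f
          left_inv f := free_hom_ext (by
            rw [freeIncl_freeDesc_app, N.map_id, Category.comp_id])
          right_inv f := by
            refine (freeIncl_freeDesc_app f (𝟙 g)).trans ?_
            rw [N.map_id]
            exact Category.comp_id f }
      homEquiv_naturality_left_symm {a b N} f k := free_hom_ext (by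
        refine (freeIncl_freeDesc_app _ _).trans ?_
        refine Eq.trans ?_ ((reassoc_of% @freeIncl_free_map) f (𝟙 g) _).symm
        refine (Category.assoc _ _ _).trans (congrArg (f ≫ ·) ?_)
        exact (freeIncl_freeDesc_app k (𝟙 g)).symm)
      homEquiv_naturality_right f k := (Category.assoc _ _ _).symm }

theorem freeAdj_homEquiv_apply {g : G} {a : A} {N : G ⥤ A} (f : (free A g).obj a ⟶ N) :
    (freeAdj A g).homEquiv a N f = freeIncl a (𝟙 g) ≫ f.app g := by
  simp [freeAdj]

theorem freeAdj_homEquiv_symm_apply {g : G} {a : A} {N : G ⥤ A}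
    (f : a ⟶ ((evaluation G A).obj g).obj N) :
    ((freeAdj A g).homEquiv a N).symm f = freeDesc f := by
  simp [freeAdj]

theorem freeIncl_evalCounit (g : G) (M : G ⥤ A) {k : G} (u : g ⟶ k) :
    freeIncl (M.obj g) u ≫ (evalCounit (freeAdj A) g M).app k = M.map u := by
  rw [evalCounit, ← (freeAdj A g).homEquiv_symm_id, freeAdj_homEquiv_symm_apply]
  exact (freeIncl_freeDesc_app _ u).trans (Category.id_comp _)

/-- Makes the presentation explicit: its transition maps are images of maps of corepresentable
functors, so naturality in the copower variable handles them. -/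
theorem transposeMap_freeAdj {g g' : G} (f : g ⟶ g') (a : A) :
    transposeMap (freeAdj A) f a =
      (Functor.const G).obj a ◁ (functorCopower G A).map (coyoneda.map f.op) := by
  apply ((freeAdj A g').homEquiv _ _).injective
  rw [← Category.comp_id (transposeMap _ _ _), homEquiv_transposeMap_comp]
  refine Eq.trans (congrArg (· ≫ ((free A g).obj a).map f) (freeAdj_homEquiv_apply _)) ?_
  refine Eq.trans ?_ (freeAdj_homEquiv_apply (g := g') (N := (free A g).obj a) _).symm
  rw [NatTrans.id_app, Category.comp_id, freeIncl_map]
  refine Eq.trans ?_ (freeIncl_whiskerLeft a f (𝟙 g')).symm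
  simp

end Generators

/-! ### Reducing tensor compatibilities to generators -/

section Relations

/-- A relation on a symmetric monoidal category which behaves like compatibility of some structure
with the tensor product of two objects. -/
structure TensorRelation {E : Type u₁} [Category.{v} E] [MonoidalCategory E]
    (R : E → E → Prop) : Prop where
  symm {M N : E} : R M N → R N M
  congr_left {M M' N : E} (e : M ≅ M') : R M N → R M' N
  assoc {M N P : E} : R M N → R N P → (R (M ⊗ N) P ↔ R M (N ⊗ P))

namespace TensorRelation

variable {E : Type u₁} [Category.{v} E] [MonoidalCategory E] [SymmetricCategory E]
  {R : E → E → Prop} (hR : TensorRelation R)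

include hR

theorem congr_right {M N N' : E} (e : N ≅ N') (h : R M N) : R M N' :=
  hR.symm (hR.congr_left e (hR.symm h))

/-- Moves from `(a ⊗ b) ⊗ (X ⊗ Y)` to `(a ⊗ X) ⊗ (b ⊗ Y)` one reassociation at a time; the remaining
hypotheses are the side conditions of `assoc`. -/
theorem tensor_tensor {a b X Y : E} (haX : R a X) (hab : R a b) (hXY : R X Y) (hbY : R b Y)
    (habX : R (a ⊗ b) X) (habXY : R (a ⊗ b) (X ⊗ Y)) : R (a ⊗ X) (b ⊗ Y) := by
  have h1 : R ((a ⊗ b) ⊗ X) Y := (hR.assoc habX hXY).2 habXY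
  have h2 : R (a ⊗ X) b :=
    hR.congr_left (β_ X a) ((hR.assoc (hR.symm haX) hab).2 (hR.symm habX))
  have h3 : R ((a ⊗ X) ⊗ b) Y :=
    hR.congr_left (α_ a b X ≪≫ whiskerLeftIso a (β_ b X) ≪≫ (α_ a X b).symm) h1
  exact (hR.assoc h2 hbY).1 h3

end TensorRelation

variable {G : Type v} [SmallCategory G]
variable {A : Type u} [Category.{v} A] [MonoidalCategory A] [SymmetricCategory A] [ComTwoRing A]

/-- A tensor relation on `G ⥤ A` closed under colimits holds everywhere if it holds between
constant functors and copowers. -/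
theorem TensorRelation.of_generators {R : (G ⥤ A) → (G ⥤ A) → Prop} (hR : TensorRelation R)
    (hcolim : ∀ (N : G ⥤ A) (J : Type v) [SmallCategory J],
      ObjectProperty.IsClosedUnderColimitsOfShape (fun M => R M N) J)
    (h₁ : ∀ a b : A, R ((Functor.const G).obj a) ((Functor.const G).obj b))
    (h₂ : ∀ X Y : G ⥤ Type v, R ((functorCopower G A).obj X) ((functorCopower G A).obj Y))
    (h₃ : ∀ (a : A) (X : G ⥤ Type v), R ((Functor.const G).obj a) ((functorCopower G A).obj X))
    (M N : G ⥤ A) : R M N := by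
  have key (a b : A) (X Y : G ⥤ Type v) :
      R ((Functor.const G).obj a ⊗ (functorCopower G A).obj X)
        ((Functor.const G).obj b ⊗ (functorCopower G A).obj Y) := by
    have e : (Functor.const G).obj (a ⊗ b) ≅ (Functor.const G).obj a ⊗ (Functor.const G).obj b :=
      (Functor.Monoidal.μIso (Functor.const G : A ⥤ G ⥤ A) a b).symm
    exact hR.tensor_tensor (h₃ a X) (h₁ a b) (h₂ X Y) (h₃ b Y) (hR.congr_left e (h₃ _ _))
      (hR.congr_left e (hR.congr_right
        (Functor.Monoidal.μIso (functorCopower G A) X Y).symm (h₃ _ _)))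
  -- Free functors have the shape treated in `key`; colimit closure extends the first variable, and
  -- by symmetry the second.
  refine prop_of_leftAdjoint_evaluation (freeAdj A) (fun M => R M N)
    (fun J _ => hcolim N J) (fun g a => hR.symm ?_) M
  exact prop_of_leftAdjoint_evaluation (freeAdj A) (fun N => R N ((free A g).obj a))
    (fun J _ => hcolim _ J) (fun g' b => key b a _ _) N

end Relations

/-! ### Monoidality of a transformation at a pair of objects -/

section MonoidalAt

open Functor.LaxMonoidal

variable {E : Type u₁} [Category.{v} E] [MonoidalCategory E] [SymmetricCategory E]
variable {D : Type u₂} [Category.{v} D] [MonoidalCategory D] [SymmetricCategory D]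
variable {H H' : E ⥤ D} [H.Braided] [H'.Braided] (ξ : H ⟶ H')

/-- Compatibility of a natural transformation with the tensor product of two objects. -/
def MonoidalAt (M N : E) : Prop :=
  μ H M N ≫ ξ.app (M ⊗ N) = (ξ.app M ⊗ₘ ξ.app N) ≫ μ H' M N

theorem monoidalAt_tensorRelation : TensorRelation (MonoidalAt ξ) where
  symm {M N} h := by
    unfold MonoidalAt at *
    rw [← cancel_epi (β_ (H.obj M) (H.obj N)).hom, ← Functor.LaxBraided.braided_assoc,
      ξ.naturality, reassoc_of% h, Functor.LaxBraided.braided,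
      BraidedCategory.braiding_naturality_assoc]
  congr_left {M M' N} e h := by
    unfold MonoidalAt at *
    rw [← cancel_epi (H.map e.hom ▷ H.obj N), μ_natural_left_assoc, ξ.naturality, reassoc_of% h,
      ← μ_natural_left, ← tensorHom_id, ← tensorHom_id, tensorHom_comp_tensorHom_assoc,
      tensorHom_comp_tensorHom_assoc, ξ.naturality]
    simp
  assoc {M N P} hMN hNP := by
    unfold MonoidalAt at *
    have h1 := associativity H M N P
    have h2 := associativity H' M N P
    -- `e1` and `e2` carry the two sides of the equation at `(M ⊗ N, P)` to those at `(M, N ⊗ P)`;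
    -- the maps `μ` in between are invertible and cancel.
    have e1 : μ H M N ▷ H.obj P ≫ μ H (M ⊗ N) P ≫ ξ.app ((M ⊗ N) ⊗ P) ≫ H'.map (α_ M N P).hom =
        (α_ _ _ _).hom ≫ H.obj M ◁ μ H N P ≫ μ H M (N ⊗ P) ≫ ξ.app (M ⊗ N ⊗ P) := by
      rw [← ξ.naturality, reassoc_of% h1]
    have e2 : μ H M N ▷ H.obj P ≫ (ξ.app (M ⊗ N) ⊗ₘ ξ.app P) ≫ μ H' (M ⊗ N) P ≫
          H'.map (α_ M N P).hom =
        (α_ _ _ _).hom ≫ H.obj M ◁ μ H N P ≫ (ξ.app M ⊗ₘ ξ.app (N ⊗ P)) ≫ μ H' M (N ⊗ P) := by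
      rw [← tensorHom_id, tensorHom_comp_tensorHom_assoc, hMN, Category.id_comp,
        ← id_tensorHom, tensorHom_comp_tensorHom_assoc, hNP, Category.id_comp,
        ← Category.comp_id (ξ.app P), ← tensorHom_comp_tensorHom_assoc, tensorHom_id, h2,
        associator_naturality_assoc, ← id_tensorHom, tensorHom_comp_tensorHom_assoc,
        Category.comp_id, Category.comp_id]
    constructor
    · intro h
      rw [← cancel_epi (H.obj M ◁ μ H N P), ← cancel_epi (α_ _ _ _).hom, ← e1, ← e2,
        reassoc_of% h]
    · intro h
      rw [← cancel_mono (H'.map (α_ M N P).hom), ← cancel_epi (μ H M N ▷ H.obj P),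
        Category.assoc, Category.assoc, e1, e2, h]

/-- Both sides are natural in `M`, with the cocontinuous source `H(-) ⊗ H N`. -/
theorem isClosedUnderColimits_monoidalAt [PreservesColimitsOfSize.{v, v} H]
    [∀ d : D, PreservesColimitsOfSize.{v, v} (tensorRight d)] (N : E) (J : Type v)
    [SmallCategory J] : ObjectProperty.IsClosedUnderColimitsOfShape (fun M => MonoidalAt ξ M N) J :=
  isClosedUnderColimits_app_eq (F := H ⋙ tensorRight (H.obj N)) (F' := tensorRight N ⋙ H')
    { app M := μ H M N ≫ ξ.app (M ⊗ N)
      naturality M M' f := by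
        dsimp
        rw [μ_natural_left_assoc, ξ.naturality, Category.assoc] }
    { app M := (ξ.app M ⊗ₘ ξ.app N) ≫ μ H' M N
      naturality M M' f := by
        dsimp
        rw [Category.assoc, ← μ_natural_left, ← tensorHom_id, ← tensorHom_id,
          tensorHom_comp_tensorHom_assoc, tensorHom_comp_tensorHom_assoc, ξ.naturality]
        simp } J

end MonoidalAt


section MonoidalComposite

open Functor.LaxMonoidal Functor.OplaxMonoidal

variable {C : Type u} [Category.{v} C] [MonoidalCategory C]
variable {E : Type u₁} [Category.{v} E] [MonoidalCategory E]
variable {D : Type u₂} [Category.{v} D] [MonoidalCategory D]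
variable (c : C ⥤ E) [c.Monoidal] (H : E ⥤ D) [H.Monoidal]

/-- Passes from `H M` to `H (M ⊗ c 𝟙)` and back, so that a transformation known on such products can
be recovered at `M`. -/
theorem rightUnitor_inv_ε_μ_map (M : E) :
    (ρ_ (H.obj M)).inv ≫ H.obj M ◁ ε (c ⋙ H) ≫ μ H M (c.obj (𝟙_ C)) ≫
      H.map (M ◁ η c ≫ (ρ_ M).hom) = 𝟙 _ := by
  rw [comp_ε, MonoidalCategory.whiskerLeft_comp, Category.assoc, Functor.map_comp,
    μ_natural_right_assoc, ← H.map_comp_assoc, ← MonoidalCategory.whiskerLeft_comp,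
    Functor.Monoidal.ε_η, MonoidalCategory.whiskerLeft_id, H.map_id, Category.id_comp,
    ← Functor.LaxMonoidal.right_unitality, Iso.inv_hom_id]

theorem leftUnitor_inv_ε_μ_map (M : E) :
    (λ_ (H.obj M)).inv ≫ ε (c ⋙ H) ▷ H.obj M ≫ μ H (c.obj (𝟙_ C)) M ≫
      H.map (η c ▷ M ≫ (λ_ M).hom) = 𝟙 _ := by
  rw [comp_ε, comp_whiskerRight, Category.assoc, Functor.map_comp,
    μ_natural_left_assoc, ← H.map_comp_assoc, ← comp_whiskerRight,
    Functor.Monoidal.ε_η, id_whiskerRight, H.map_id, Category.id_comp,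
    ← Functor.LaxMonoidal.left_unitality, Iso.inv_hom_id]

end MonoidalComposite

section MonoidalAtComp

open Functor.LaxMonoidal Functor.OplaxMonoidal

variable {C : Type u} [Category.{v} C] [MonoidalCategory C]
variable {E : Type u₁} [Category.{v} E] [MonoidalCategory E] [SymmetricCategory E]
variable {D : Type u₂} [Category.{v} D] [MonoidalCategory D] [SymmetricCategory D]
variable (c : C ⥤ E) [c.Monoidal] {H H' : E ⥤ D} [H.Braided] [H'.Braided] (ξ : H ⟶ H')

theorem monoidalAt_obj_obj [h : NatTrans.IsMonoidal (Functor.whiskerLeft c ξ)] (a b : C) :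
    MonoidalAt ξ (c.obj a) (c.obj b) := by
  have h1 := h.tensor a b
  dsimp at h1
  rw [Category.assoc, ξ.naturality] at h1
  unfold MonoidalAt
  rw [← cancel_mono (H'.map (μ c a b)), Category.assoc, Category.assoc]
  exact h1

theorem unit_of_whiskerLeft [h : NatTrans.IsMonoidal (Functor.whiskerLeft c ξ)] :
    ε H ≫ ξ.app (𝟙_ E) = ε H' := by
  have h1 := h.unit
  dsimp at h1
  rw [Category.assoc, ξ.naturality] at h1
  rw [← cancel_mono (H'.map (ε c)), Category.assoc]
  exact h1

end MonoidalAtComp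

/-! ### Extending transformations from constants and copowers -/

section Extension

open Functor.LaxMonoidal Functor.OplaxMonoidal

variable {G : Type v} [SmallCategory G]
variable {A : Type u} [Category.{v} A] [MonoidalCategory A] [SymmetricCategory A] [ComTwoRing A]
variable {D : Type u₂} [Category.{v} D] [MonoidalCategory D] [SymmetricCategory D]
variable {H H' : (G ⥤ A) ⥤ D} [H.Braided] [H'.Braided]

theorem isMonoidal_of_generators [PreservesColimitsOfSize.{v, v} H]
    [∀ d : D, PreservesColimitsOfSize.{v, v} (tensorRight d)] (ξ : H ⟶ H')
    [NatTrans.IsMonoidal (Functor.whiskerLeft (Functor.const G : A ⥤ G ⥤ A) ξ)]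
    [NatTrans.IsMonoidal (Functor.whiskerLeft (functorCopower G A) ξ)]
    (h : ∀ a X, MonoidalAt ξ ((Functor.const G).obj a) ((functorCopower G A).obj X)) :
    NatTrans.IsMonoidal ξ where
  unit := unit_of_whiskerLeft (functorCopower G A) ξ
  tensor := (monoidalAt_tensorRelation ξ).of_generators
    (fun N J _ => isClosedUnderColimits_monoidalAt ξ N J)
    (fun a b => monoidalAt_obj_obj (Functor.const G : A ⥤ G ⥤ A) ξ a b)
    (fun X Y => monoidalAt_obj_obj (functorCopower G A) ξ X Y) h

/-- Since `μ` is invertible, values on the factors determine values on free functors, and agreement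
is closed under colimits. -/
theorem eq_of_generators [PreservesColimitsOfSize.{v, v} H] (ξ ξ' : H ⟶ H')
    [NatTrans.IsMonoidal ξ] [NatTrans.IsMonoidal ξ']
    (h₁ : ∀ a : A, ξ.app ((Functor.const G).obj a) = ξ'.app ((Functor.const G).obj a))
    (h₂ : ∀ X, ξ.app ((functorCopower G A).obj X) = ξ'.app ((functorCopower G A).obj X)) :
    ξ = ξ' := by
  ext M
  refine prop_of_leftAdjoint_evaluation (freeAdj A) (fun M => ξ.app M = ξ'.app M)
    (fun J _ => isClosedUnderColimits_app_eq ξ ξ' J) (fun g a => ?_) M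
  refine (cancel_epi (μ H ((Functor.const G).obj a)
    ((functorCopower G A).obj (coyoneda.obj (Opposite.op g))))).1 ?_
  refine (NatTrans.IsMonoidal.tensor _ _).trans (Eq.trans ?_ (NatTrans.IsMonoidal.tensor _ _).symm)
  rw [h₁, h₂]

variable (τ : (Functor.const G : A ⥤ G ⥤ A) ⋙ H ⟶ Functor.const G ⋙ H')
  (θ : functorCopower G A ⋙ H ⟶ functorCopower G A ⋙ H')

/-- The value on the product of a constant functor and a copower of the extension of a pair of
natural transformations. -/
def extensionApp (a : A) (X : G ⥤ Type v) :
    H.obj ((Functor.const G).obj a ⊗ (functorCopower G A).obj X) ⟶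
      H'.obj ((Functor.const G).obj a ⊗ (functorCopower G A).obj X) :=
  δ H _ _ ≫ (τ.app a ⊗ₘ θ.app X) ≫ μ H' _ _

theorem map_extensionApp {a b : A} (f : a ⟶ b) {X Y : G ⥤ Type v} (g : X ⟶ Y) :
    H.map ((Functor.const G).map f ⊗ₘ (functorCopower G A).map g) ≫ extensionApp τ θ b Y =
      extensionApp τ θ a X ≫
        H'.map ((Functor.const G).map f ⊗ₘ (functorCopower G A).map g) := by
  have h1 := τ.naturality f
  have h2 := θ.naturality g
  dsimp only [Functor.comp_map] at h1 h2
  unfold extensionApp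
  rw [Category.assoc, Category.assoc, ← μ_natural, ← δ_natural_assoc,
    tensorHom_comp_tensorHom_assoc, tensorHom_comp_tensorHom_assoc, h1, h2]

theorem map_extensionApp_left {a b : A} (f : a ⟶ b) (X : G ⥤ Type v) :
    H.map ((Functor.const G).map f ▷ (functorCopower G A).obj X) ≫ extensionApp τ θ b X =
      extensionApp τ θ a X ≫
        H'.map ((Functor.const G).map f ▷ (functorCopower G A).obj X) := by
  have h := map_extensionApp τ θ f (𝟙 X)
  rwa [CategoryTheory.Functor.map_id, tensorHom_id] at h

theorem map_extensionApp_right (a : A) {X Y : G ⥤ Type v} (g : X ⟶ Y) :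
    H.map ((Functor.const G).obj a ◁ (functorCopower G A).map g) ≫ extensionApp τ θ a Y =
      extensionApp τ θ a X ≫
        H'.map ((Functor.const G).obj a ◁ (functorCopower G A).map g) := by
  have h := map_extensionApp τ θ (𝟙 a) g
  rwa [CategoryTheory.Functor.map_id, id_tensorHom] at h

/-- The value on a free functor of the extension of a pair of natural transformations. -/
def extensionFree (g : G) (a : A) : H.obj ((free A g).obj a) ⟶ H'.obj ((free A g).obj a) :=
  extensionApp τ θ a (coyoneda.obj (Opposite.op g))

theorem map_extensionFree (g : G) {a b : A} (f : a ⟶ b) :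
    H.map ((free A g).map f) ≫ extensionFree τ θ g b =
      extensionFree τ θ g a ≫ H'.map ((free A g).map f) :=
  map_extensionApp_left τ θ f _

theorem transposeMap_extensionFree {g g' : G} (f : g ⟶ g') (a : A) :
    H.map (transposeMap (freeAdj A) f a) ≫ extensionFree τ θ g a =
      extensionFree τ θ g' a ≫ H'.map (transposeMap (freeAdj A) f a) := by
  rw [transposeMap_freeAdj]
  exact map_extensionApp_right τ θ a _

/-- The morphism from a free functor to the product of a constant functor and a copower
corresponding to an element. -/
def freeElement (g : G) (a : A) (X : G ⥤ Type v) (x : X.obj g) :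
    (free A g).obj a ⟶ (Functor.const G).obj a ⊗ (functorCopower G A).obj X :=
  (Functor.const G).obj a ◁ (functorCopower G A).map (coyonedaEquiv.symm x)

theorem map_freeElement_extensionApp (g : G) (a : A) (X : G ⥤ Type v) (x : X.obj g) :
    H.map (freeElement g a X x) ≫ extensionApp τ θ a X =
      extensionFree τ θ g a ≫ H'.map (freeElement g a X x) :=
  map_extensionApp_right τ θ a _

/-- Restricted to the summand of an element `x`, a leg of the presentation is induced by the map of
set-valued functors that `x` classifies. -/
theorem free_map_incl_evalCounit (g : G) (a : A) (X : G ⥤ Type v) (x : X.obj g) :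
    (free A g).map (incl a x) ≫
        evalCounit (freeAdj A) g ((Functor.const G).obj a ⊗ (functorCopower G A).obj X) =
      freeElement g a X x := by
  refine free_hom_ext ?_
  refine ((reassoc_of% @freeIncl_free_map) (incl a x) (𝟙 g) _).trans ?_
  refine (congrArg (incl a x ≫ ·) (freeIncl_evalCounit g
    ((Functor.const G).obj a ⊗ (functorCopower G A).obj X) (𝟙 g))).trans ?_
  refine (congrArg (incl a x ≫ ·) (CategoryTheory.Functor.map_id _ _)).trans ?_
  refine (Category.comp_id _).trans ?_
  refine Eq.trans ?_ (incl_map a (S := g ⟶ g) (𝟙 g) ((coyonedaEquiv.symm x).app g)).symm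
  congr 1
  simp [coyonedaEquiv]

instance (g : G) : PreservesColimitsOfSize.{v, v} (free A g) :=
  (freeAdj A g).leftAdjoint_preservesColimits

theorem map_incl_hom_ext (F : A ⥤ D) [PreservesColimitsOfSize.{v, v} F] {a : A} {S : Type v}
    {d : D} {m m' : F.obj (a ⊗ (copower A).obj S) ⟶ d}
    (h : ∀ s : S, F.map (incl a s) ≫ m = F.map (incl a s) ≫ m') : m = m' :=
  Cofan.IsColimit.hom_ext
    (isColimitCofanMkObjOfIsColimit F (fun _ : S => a) _ (isColimitIncl a S)) _ _ h

/-- The forced values on free functors commute with both maps of each presentation, hence glue. -/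
theorem exists_extension [PreservesColimitsOfSize.{v, v} H] :
    ∃ ξ : H ⟶ H', ∀ a X, ξ.app ((Functor.const G).obj a ⊗ (functorCopower G A).obj X) =
      extensionApp τ θ a X := by
  have hex (M : G ⥤ A) : ∃ m : H.obj M ⟶ H'.obj M, ∀ g,
      H.map (evalCounit (freeAdj A) g M) ≫ m =
        extensionFree τ θ g (M.obj g) ≫ H'.map (evalCounit (freeAdj A) g M) :=
    exists_map_evalCounit_comp (freeAdj A) H _ fun {g g'} f => by
      rw [reassoc_of% @transposeMap_extensionFree, reassoc_of% @map_extensionFree, ← H'.map_comp,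
        ← H'.map_comp, transposeMap_evalCounit]
  choose m hm using hex
  refine ⟨{ app := m, naturality := fun M N f => ?_ }, fun a X => ?_⟩
  · refine map_evalCounit_hom_ext (freeAdj A) H fun g => ?_
    rw [reassoc_of% (hm M g), ← H.map_comp_assoc, ← evalCounit_naturality, ← H'.map_comp,
      ← evalCounit_naturality, H.map_comp_assoc, hm N g, H'.map_comp,
      reassoc_of% @map_extensionFree]
  -- The glued map was prescribed only on free functors; elements of `X` reduce the general product
  -- to that case.
  · refine map_evalCounit_hom_ext (freeAdj A) H fun g => ?_
    refine map_incl_hom_ext (free A g ⋙ H) fun x => ?_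
    dsimp only [Functor.comp_map]
    have h := free_map_incl_evalCounit g a X x
    refine (congrArg (H.map ((free A g).map (incl a x)) ≫ ·) (hm _ g)).trans ?_
    refine ((reassoc_of% @map_extensionFree) τ θ g (incl a x) _).trans ?_
    refine (congrArg (extensionFree τ θ g a ≫ ·)
      ((H'.map_comp _ _).symm.trans (congrArg H'.map h))).trans ?_
    rw [← map_freeElement_extensionApp]
    exact (congrArg (· ≫ extensionApp τ θ a X)
      ((congrArg H.map h.symm).trans (H.map_comp _ _))).trans (Category.assoc _ _ _)

theorem exists_isMonoidal_extension [PreservesColimitsOfSize.{v, v} H]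
    [∀ d : D, PreservesColimitsOfSize.{v, v} (tensorRight d)]
    [hτ : NatTrans.IsMonoidal τ] [hθ : NatTrans.IsMonoidal θ] :
    ∃ ξ : H ⟶ H', NatTrans.IsMonoidal ξ ∧ Functor.whiskerLeft (Functor.const G) ξ = τ ∧
      Functor.whiskerLeft (functorCopower G A) ξ = θ := by
  obtain ⟨ξ, hξ⟩ := exists_extension τ θ
  have hμ (a : A) (X : G ⥤ Type v) :
      μ H _ _ ≫ ξ.app ((Functor.const G).obj a ⊗ (functorCopower G A).obj X) =
        (τ.app a ⊗ₘ θ.app X) ≫ μ H' _ _ := by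
    rw [hξ, extensionApp, Functor.Monoidal.μ_δ_assoc]
  -- Tensor the constant functor with the copower of the unit; unitality of `θ` removes the second
  -- factor.
  have h₁ : Functor.whiskerLeft (Functor.const G) ξ = τ := by
    ext a
    have e := rightUnitor_inv_ε_μ_map (functorCopower G A) H ((Functor.const G).obj a)
    have e' := rightUnitor_inv_ε_μ_map (functorCopower G A) H' ((Functor.const G).obj a)
    have hu := hθ.unit
    change ξ.app ((Functor.const G).obj a) = τ.app a
    rw [← Category.id_comp (ξ.app _), ← e]
    simp only [Category.assoc]
    rw [ξ.naturality, reassoc_of% (hμ a _), ← id_tensorHom, tensorHom_comp_tensorHom_assoc, hu,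
      Category.id_comp, ← Category.id_comp (ε (functorCopower G A ⋙ H')),
      ← Category.comp_id (τ.app a), ← tensorHom_comp_tensorHom_assoc, tensorHom_id, id_tensorHom,
      ← rightUnitor_inv_naturality_assoc, Category.comp_id]
    exact (congrArg (τ.app a ≫ ·) e').trans (Category.comp_id _)
  have h₂ : Functor.whiskerLeft (functorCopower G A) ξ = θ := by
    ext X : 2
    have e := leftUnitor_inv_ε_μ_map (Functor.const G : A ⥤ G ⥤ A) H ((functorCopower G A).obj X)
    have e' := leftUnitor_inv_ε_μ_map (Functor.const G : A ⥤ G ⥤ A) H' ((functorCopower G A).obj X)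
    have hu := hτ.unit
    change ξ.app ((functorCopower G A).obj X) = θ.app X
    rw [← Category.id_comp (ξ.app _), ← e]
    simp only [Category.assoc]
    rw [ξ.naturality, reassoc_of% (hμ (𝟙_ A) X), ← tensorHom_id, tensorHom_comp_tensorHom_assoc, hu,
      Category.id_comp, ← Category.id_comp (ε ((Functor.const G : A ⥤ G ⥤ A) ⋙ H')),
      ← Category.comp_id (θ.app X), ← tensorHom_comp_tensorHom_assoc, tensorHom_id, id_tensorHom,
      ← leftUnitor_inv_naturality_assoc, Category.comp_id]
    exact (congrArg (θ.app X ≫ ·) e').trans (Category.comp_id _)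
  refine ⟨ξ, ?_, h₁, h₂⟩
  have i₁ : NatTrans.IsMonoidal (Functor.whiskerLeft (Functor.const G : A ⥤ G ⥤ A) ξ) := by
    rw [h₁]; exact hτ
  have i₂ : NatTrans.IsMonoidal (Functor.whiskerLeft (functorCopower G A) ξ) := by
    rw [h₂]; exact hθ
  refine isMonoidal_of_generators ξ fun a X => (hμ a X).trans ?_
  rw [← h₁, ← h₂]
  rfl

end Extension


/-! ### Restriction is fully faithful -/

section Restriction

variable {G : Type v} [SmallCategory G]
variable {A : Type u} [Category.{v} A] [MonoidalCategory A] [SymmetricCategory A] [ComTwoRing A]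
variable [ComTwoRing (G ⥤ A)] {L : (G ⥤ A) ⥤ A} (adj : (Functor.const G : A ⥤ G ⥤ A) ⊣ L)

/-- Restriction of 1-morphisms of algebras along the copower 1-morphism. -/
def restriction : TannakaKrein G A adj ⥤ Hom (G ⥤ Type v) A where
  obj φ := (copowerHom G A).comp φ.hom
  map s := (copowerHom G A).whisker s.trans
  map_id _ := Hom.whisker_id _ _
  map_comp _ _ := Hom.whisker_comp _ _ _

/-- The component of the structure isomorphism of a 1-morphism of algebras `(G ⥤ A) → A`. -/
def constNat (φ : TannakaKrein G A adj) : 𝟭 A ⟶ Functor.const G ⋙ φ.hom.left := φ.ζ.hom.nat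

/-- The component of the inverse structure isomorphism of a 1-morphism of algebras
`(G ⥤ A) → A`. -/
def constNatInv (φ : TannakaKrein G A adj) : Functor.const G ⋙ φ.hom.left ⟶ 𝟭 A := φ.ζ.inv.nat

instance (φ : TannakaKrein G A adj) : NatTrans.IsMonoidal (constNat adj φ) := φ.ζ.hom.isMonoidal

instance (φ : TannakaKrein G A adj) : NatTrans.IsMonoidal (constNatInv adj φ) :=
  φ.ζ.inv.isMonoidal

theorem constNat_comp_constNatInv (φ : TannakaKrein G A adj) :
    constNat adj φ ≫ constNatInv adj φ = 𝟙 _ :=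
  congrArg Hom.Trans.nat φ.ζ.hom_inv_id

theorem constNatInv_comp_constNat (φ : TannakaKrein G A adj) :
    constNatInv adj φ ≫ constNat adj φ = 𝟙 _ :=
  congrArg Hom.Trans.nat φ.ζ.inv_hom_id

theorem constNat_comp_whiskerLeft {φ ψ : TannakaKrein G A adj} (s : φ ⟶ ψ) :
    constNat adj φ ≫ Functor.whiskerLeft (Functor.const G) s.trans.nat = constNat adj ψ :=
  congrArg Hom.Trans.nat s.w

instance preservesColimits_left {B : Type u₁} [Category.{v} B] [MonoidalCategory B]
    [SymmetricCategory B] [ComTwoRing B] {C : Type u₂} [Category.{v} C] [MonoidalCategory C]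
    [SymmetricCategory C] [ComTwoRing C] (f : Hom B C) :
    PreservesColimitsOfSize.{v, v} f.left :=
  f.adj.leftAdjoint_preservesColimits

instance : (restriction adj).Faithful where
  map_injective {φ ψ s t} h := by
    refine AlgHom.Trans.ext (Hom.Trans.ext ?_)
    have := s.trans.isMonoidal
    have := t.trans.isMonoidal
    refine eq_of_generators s.trans.nat t.trans.nat (fun a => ?_) (fun X => ?_)
    -- As `ζ` is invertible, the compatibility `w` determines a 2-morphism on constants.
    · have h1 := (constNat_comp_whiskerLeft adj s).trans (constNat_comp_whiskerLeft adj t).symm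
      have h2 := congrArg (constNatInv adj φ ≫ ·) h1
      simp only [← Category.assoc, constNatInv_comp_constNat, Category.id_comp] at h2
      exact NatTrans.congr_app h2 a
    · exact NatTrans.congr_app (congrArg Hom.Trans.nat h) X

instance : (restriction adj).Full where
  map_surjective {φ ψ} θ := by
    have : NatTrans.IsMonoidal (F₁ := functorCopower G A ⋙ φ.hom.left)
      (F₂ := functorCopower G A ⋙ ψ.hom.left) θ.nat := θ.isMonoidal
    -- On constants, the only choice allowed by `w` is the inverse of one `ζ` followed by the other.
    obtain ⟨ξ, hξ, h₁, h₂⟩ := exists_isMonoidal_extension (H := φ.hom.left) (H' := ψ.hom.left)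
      (constNatInv adj φ ≫ constNat adj ψ) θ.nat
    refine ⟨⟨⟨ξ, hξ⟩, Hom.Trans.ext ?_⟩, Hom.Trans.ext h₂⟩
    change constNat adj φ ≫ Functor.whiskerLeft (Functor.const G) ξ = constNat adj ψ
    rw [h₁, ← Category.assoc, constNat_comp_constNatInv, Category.id_comp]

end Restriction


/-! ### Oplax structures from comonoids and from colimits -/

section TensorComon

open Functor.OplaxMonoidal

variable {E : Type u} [Category.{v} E] [MonoidalCategory E]

/-- The constant functor at a comonoid object is oplax monoidal. -/
@[reducible]
def constOplaxMonoidal (D : Type u₁) [Category.{v} D] [MonoidalCategory D] (C : E) [ComonObj C] :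
    ((Functor.const D).obj C).OplaxMonoidal where
  η := ComonObj.counit (X := C)
  δ _ _ := ComonObj.comul (X := C)
  oplax_associativity _ _ _ := by simp
  oplax_left_unitality _ := by simp
  oplax_right_unitality _ := by simp

variable [SymmetricCategory E] (C : E) [ComonObj C]

attribute [local instance] constOplaxMonoidal

/-- Tensoring on the right with a comonoid object. -/
def tensorComon (C : E) : E ⥤ E := (𝟭 E).prod' ((Functor.const E).obj C) ⋙ tensor E

instance : (tensorComon C).OplaxMonoidal :=
  inferInstanceAs ((𝟭 E).prod' ((Functor.const E).obj C) ⋙ tensor E).OplaxMonoidal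

theorem tensorComon_δ (M N : E) :
    δ (tensorComon C) M N = (M ⊗ N) ◁ ComonObj.comul ≫ tensorδ M C N C := by
  refine (comp_δ ((𝟭 E).prod' ((Functor.const E).obj C)) (tensor E) M N).trans ?_
  simp
  rfl

theorem tensorComon_η :
    η (tensorComon C) = 𝟙_ E ◁ ComonObj.counit (X := C) ≫ (λ_ (𝟙_ E)).hom := by
  refine (comp_η ((𝟭 E).prod' ((Functor.const E).obj C)) (tensor E)).trans ?_
  simp
  rfl

end TensorComon

section Colim

open Functor.OplaxMonoidal

variable (J : Type v) [SmallCategory J]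
variable (A : Type u) [Category.{v} A] [MonoidalCategory A] [SymmetricCategory A] [ComTwoRing A]

/-- Left adjoint to the monoidal constant-diagram functor. -/
instance : (colim : (J ⥤ A) ⥤ A).OplaxMonoidal := colimConstAdj.leftAdjointOplaxMonoidal

variable {J A}

theorem ι_homEquiv_symm {M : J ⥤ A} {a : A} (f : M ⟶ (Functor.const J).obj a) (j : J) :
    colimit.ι M j ≫ (colimConstAdj.homEquiv M a).symm f = f.app j := by
  have h := (colimConstAdj.homEquiv M a).apply_symm_apply f
  exact NatTrans.congr_app h j

theorem ι_colim_δ (M N : J ⥤ A) (j : J) :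
    colimit.ι (M ⊗ N) j ≫ δ colim M N = colimit.ι M j ⊗ₘ colimit.ι N j := by
  refine (ι_homEquiv_symm _ j).trans ?_
  exact Category.comp_id _

theorem ι_colim_η (j : J) : colimit.ι (𝟙_ (J ⥤ A)) j ≫ η (colim : (J ⥤ A) ⥤ A) = 𝟙 _ :=
  ι_homEquiv_symm _ j

end Colim

section Comon

variable {J : Type u₁} [Category.{u₂} J] {G : Type v} [SmallCategory G]

/-- The diagonal of a set-valued functor. -/
def diagonal (X : G ⥤ Type v) : X ⟶ X ⊗ X where
  app g := ↾fun x => (x, x)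

/-- The morphism from a set-valued functor to the tensor unit. -/
def toPoint (X : G ⥤ Type v) : X ⟶ 𝟙_ (G ⥤ Type v) where
  app g := ↾fun _ => PUnit.unit

/-- The pointwise diagonals make any functor to `G ⥤ Type v` a comonoid object. -/
instance (Y : J ⥤ G ⥤ Type v) : ComonObj Y where
  counit := { app j := toPoint (Y.obj j) }
  comul := { app j := diagonal (Y.obj j) }
  counit_comul := rfl
  comul_counit := rfl
  comul_assoc := rfl

end Comon

/-! ### The coend extension and its oplax structure -/

section Coend

open Functor.OplaxMonoidal

variable (G : Type v) [SmallCategory G]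

/-- The opposite of the twisted arrow category. -/
abbrev Tw : Type v := ((Functor.hom G).Elements)ᵒᵖ

/-- The source functor of the twisted arrow category. -/
def twSource : Tw G ⥤ G :=
  (CategoryOfElements.π (Functor.hom G) ⋙ CategoryTheory.Prod.fst _ _).leftOp

/-- The functor sending an arrow to the functor corepresented by its target. -/
def twCorep : Tw G ⥤ G ⥤ Type v :=
  (CategoryOfElements.π (Functor.hom G) ⋙ CategoryTheory.Prod.snd _ _).op ⋙ coyoneda

variable {G}
variable {A : Type u} [Category.{v} A] [MonoidalCategory A] [SymmetricCategory A] [ComTwoRing A]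
variable (F : (G ⥤ Type v) ⥤ A) [F.Braided]

attribute [local instance] Functor.obj.instComonObj

/-- The functor sending an arrow to the value of `F` at the functor corepresented by its target. -/
abbrev twValue : Tw G ⥤ A := ((Functor.whiskeringRight (Tw G) (G ⥤ Type v) A).obj F).obj (twCorep G)

/-- The diagram of which `coendFunctor` is the colimit. -/
abbrev coendDiagram (M : G ⥤ A) : Tw G ⥤ A :=
  (tensorComon (twValue F)).obj (((Functor.whiskeringLeft (Tw G) G A).obj (twSource G)).obj M)

/-- The coend of the functors `M g ⊗ F (G(g, -))`. -/
def coendFunctor : (G ⥤ A) ⥤ A :=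
  (Functor.whiskeringLeft (Tw G) G A).obj (twSource G) ⋙
    tensorComon (twValue F) ⋙ colim

/-- The oplax monoidal structure of the coend functor. -/
@[reducible]
def coendOplaxMonoidal : (coendFunctor F).OplaxMonoidal :=
  inferInstanceAs ((Functor.whiskeringLeft (Tw G) G A).obj (twSource G) ⋙
    tensorComon (twValue F) ⋙
      colim).OplaxMonoidal

attribute [local instance] coendOplaxMonoidal

instance : PreservesColimitsOfSize.{v, v} (coendFunctor F) := by
  have : PreservesColimitsOfSize.{v, v}
      (tensorComon (twValue F)) :=
    preservesColimits_of_natIso (NatIso.ofComponents (fun _ => Iso.refl _) (fun f => by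
      exact (Category.comp_id _).trans ((tensorHom_id f (twValue F)).symm.trans
        (Category.id_comp _).symm)) : tensorRight (twValue F) ≅ tensorComon (twValue F))
  have : PreservesColimitsOfSize.{v, v} (colim : (Tw G ⥤ A) ⥤ A) :=
    colimConstAdj.leftAdjoint_preservesColimits
  unfold coendFunctor
  infer_instance

/-- The value of `F` at the functor corepresented by an object. -/
abbrev corep (g : G) : A := F.obj (coyoneda.obj (Opposite.op g))

/-- The comultiplication of `corep F g`. -/
def corepComul (g : G) : corep F g ⟶ corep F g ⊗ corep F g :=
  F.map (diagonal _) ≫ δ F _ _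

/-- The counit of `corep F g`. -/
def corepCounit (g : G) : corep F g ⟶ 𝟙_ A := F.map (toPoint _) ≫ η F

/-- The action on `corep F` of a morphism. -/
abbrev corepMap {g g' : G} (f : g ⟶ g') : corep F g' ⟶ corep F g := F.map (coyoneda.map f.op)

/-- The arrow `f` as an object of the twisted arrow category. -/
def twMk {g g' : G} (f : g ⟶ g') : Tw G :=
  Opposite.op ⟨(Opposite.op g, g'), f⟩

/-- The coprojections of `coendFunctor` indexed by arrows. -/
def coendArrow (M : G ⥤ A) {g g' : G} (f : g ⟶ g') :
    M.obj g ⊗ corep F g' ⟶ (coendFunctor F).obj M :=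
  colimit.ι (coendDiagram F M) (twMk f)

/-- The coprojections of `coendFunctor`. -/
def coendι (M : G ⥤ A) (g : G) : M.obj g ⊗ corep F g ⟶ (coendFunctor F).obj M :=
  coendArrow F M (𝟙 g)

/-- An arrow maps, in the opposite twisted arrow category, to the identities of its source and of
its target; comparing the two factorizations gives dinaturality. -/
theorem coendArrow_eq_left (M : G ⥤ A) {g g' : G} (f : g ⟶ g') :
    coendArrow F M f = M.obj g ◁ corepMap F f ≫ coendι F M g := by
  let φ : twMk f ⟶ twMk (𝟙 g) :=
    Quiver.Hom.op (V := (Functor.hom G).Elements)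
      ⟨(𝟙 _, f), by
        simp only [Functor.hom]
        exact (Category.id_comp _).trans (Category.id_comp _)⟩
  refine (colimit.w (coendDiagram F M) φ).symm.trans ?_
  refine congrArg (· ≫ coendι F M g) ?_
  change M.map (𝟙 g) ⊗ₘ corepMap F f = _
  rw [M.map_id, id_tensorHom]

theorem coendArrow_eq_right (M : G ⥤ A) {g g' : G} (f : g ⟶ g') :
    coendArrow F M f = M.map f ▷ corep F g' ≫ coendι F M g' := by
  let φ : twMk f ⟶ twMk (𝟙 g') :=
    Quiver.Hom.op (V := (Functor.hom G).Elements)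
      ⟨(f.op, 𝟙 g'), (congrArg (f ≫ ·) (Category.id_comp _)).trans (Category.comp_id _)⟩
  refine (colimit.w (coendDiagram F M) φ).symm.trans ?_
  refine congrArg (· ≫ coendι F M g') ?_
  change M.map f ⊗ₘ F.map (coyoneda.map (𝟙 _)) = _
  rw [CategoryTheory.Functor.map_id, CategoryTheory.Functor.map_id]
  exact tensorHom_id _ _

theorem coendι_dinatural (M : G ⥤ A) {g g' : G} (f : g ⟶ g') :
    M.obj g ◁ corepMap F f ≫ coendι F M g = M.map f ▷ corep F g' ≫ coendι F M g' :=
  (coendArrow_eq_left F M f).symm.trans (coendArrow_eq_right F M f)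

variable {F}

theorem ι_colim_map_comp {J : Type v} [SmallCategory J] {D D' : J ⥤ A} (m : D ⟶ D') (j : J) {a : A}
    (x : colim.obj D' ⟶ a) :
    colimit.ι D j ≫ colim.map m ≫ x = m.app j ≫ colimit.ι D' j ≫ x :=
  ι_colimMap_assoc _ _ _

theorem coend_hom_ext {M : G ⥤ A} {a : A} {m m' : (coendFunctor F).obj M ⟶ a}
    (h : ∀ g, coendι F M g ≫ m = coendι F M g ≫ m') : m = m' := by
  refine colimit.hom_ext ?_
  rintro ⟨⟨⟨⟨g⟩, g'⟩, f⟩⟩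
  have hf : ∀ f : g ⟶ g', coendArrow F M f ≫ m = coendArrow F M f ≫ m' := fun f => by
    rw [coendArrow_eq_left, Category.assoc, Category.assoc, h]
  exact hf f

/-- Upgrades dinaturality to naturality over every morphism of twisted arrows, as a cocone requires.
-/
theorem dinatural_comp {M : G ⥤ A} {a : A} (k : ∀ g, M.obj g ⊗ corep F g ⟶ a)
    (hk : ∀ {g g' : G} (f : g ⟶ g'),
      M.obj g ◁ corepMap F f ≫ k g = M.map f ▷ corep F g' ≫ k g') {g g' h h' : G} (p : g ⟶ h)
    (f' : h ⟶ h') (q : h' ⟶ g') (f : g ⟶ g') (w : (p ≫ f') ≫ q = f) :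
    (M.map p ⊗ₘ corepMap F q) ≫ M.obj h ◁ corepMap F f' ≫ k h = M.obj g ◁ corepMap F f ≫ k g := by
  subst w
  simp only [corepMap, op_comp, CategoryTheory.Functor.map_comp, MonoidalCategory.whiskerLeft_comp,
    Category.assoc]
  rw [hk p, tensorHom_def', Category.assoc, ← whisker_exchange_assoc]

/-- The morphism out of a coend given by a dinatural family. -/
def coendDesc {M : G ⥤ A} {a : A} (k : ∀ g, M.obj g ⊗ corep F g ⟶ a)
    (hk : ∀ {g g' : G} (f : g ⟶ g'),
      M.obj g ◁ corepMap F f ≫ k g = M.map f ▷ corep F g' ≫ k g') :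
    (coendFunctor F).obj M ⟶ a :=
  colimit.desc (coendDiagram F M)
    { pt := a
      ι :=
        { app j := M.obj ((twSource G).obj j) ◁ F.map (coyoneda.map (Quiver.Hom.op j.unop.2)) ≫
            k ((twSource G).obj j)
          naturality i j φ :=
            (dinatural_comp k hk φ.unop.1.1.unop j.unop.2 φ.unop.1.2 i.unop.2
              ((Category.assoc _ _ _).trans φ.unop.2)).trans
              (Category.comp_id _).symm } }

theorem coendι_desc {M : G ⥤ A} {a : A} (k : ∀ g, M.obj g ⊗ corep F g ⟶ a)
    (hk : ∀ {g g' : G} (f : g ⟶ g'),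
      M.obj g ◁ corepMap F f ≫ k g = M.map f ▷ corep F g' ≫ k g') (g : G) :
    coendι F M g ≫ coendDesc k hk = k g := by
  refine (colimit.ι_desc _ _).trans ?_
  change M.obj g ◁ F.map (coyoneda.map (𝟙 _)) ≫ k g = k g
  simp

variable (F)

theorem coendι_map {M N : G ⥤ A} (m : M ⟶ N) (g : G) :
    coendι F M g ≫ (coendFunctor F).map m = m.app g ▷ corep F g ≫ coendι F N g := by
  refine (ι_colimMap _ _).trans ?_
  refine congrArg (· ≫ coendι F N g) ?_
  exact tensorHom_id _ _

theorem coendι_δ (M N : G ⥤ A) (g : G) :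
    coendι F (M ⊗ N) g ≫ δ (coendFunctor F) M N =
      (M.obj g ⊗ N.obj g) ◁ corepComul F g ≫ tensorδ _ _ _ _ ≫
        (coendι F M g ⊗ₘ coendι F N g) := by
  -- Restriction along `twSource` is strictly monoidal and contributes only an identity.
  have h₁ : δ (coendFunctor F) M N = colim.map (δ (tensorComon (twValue F))
      (((Functor.whiskeringLeft (Tw G) G A).obj (twSource G)).obj M)
      (((Functor.whiskeringLeft (Tw G) G A).obj (twSource G)).obj N)) ≫ δ colim _ _ := by
    refine (comp_δ ((Functor.whiskeringLeft (Tw G) G A).obj (twSource G))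
      (tensorComon (twValue F) ⋙ colim) M N).trans ?_
    refine (congrArg (· ≫ _) (CategoryTheory.Functor.map_id _ _)).trans ?_
    exact (Category.id_comp _).trans (comp_δ _ _ _ _)
  rw [h₁]
  refine (ι_colim_map_comp _ _ _).trans ?_
  refine (congrArg _ (ι_colim_δ _ _ _)).trans ?_
  refine (congrArg (· ≫ _) (NatTrans.congr_app (tensorComon_δ (twValue F) _ _) _)).trans ?_
  exact Category.assoc _ _ _

theorem coendι_η (g : G) :
    coendι F (𝟙_ (G ⥤ A)) g ≫ η (coendFunctor F) =
      𝟙_ A ◁ corepCounit F g ≫ (λ_ (𝟙_ A)).hom := by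
  have h₁ : η (coendFunctor F) = colim.map (η (tensorComon (twValue F))) ≫ η colim := by
    refine (comp_η ((Functor.whiskeringLeft (Tw G) G A).obj (twSource G))
      (tensorComon (twValue F) ⋙ colim)).trans ?_
    refine (congrArg (· ≫ _) (CategoryTheory.Functor.map_id _ _)).trans ?_
    exact (Category.id_comp _).trans (comp_η _ _)
  rw [h₁]
  refine (ι_colim_map_comp _ _ _).trans ?_
  refine (congrArg _ (ι_colim_η _)).trans ?_
  refine (Category.comp_id _).trans ?_
  exact NatTrans.congr_app (tensorComon_η (twValue F)) _

end Coend


/-! ### Interchange identities for coalgebras -/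

section Interchange

variable {E : Type u} [Category.{v} E] [MonoidalCategory E] [SymmetricCategory E]

theorem tensorδ_eq_tensorμ (W X Y Z : E) : tensorδ W X Y Z = tensorμ W Y X Z := by
  simp [tensorδ, tensorμ, SymmetricCategory.braiding_swap_eq_inv_braiding X Y]

theorem tensorμ_rightUnitor (a b : E) :
    tensorμ a b (𝟙_ E) (𝟙_ E) ≫ ((ρ_ a).hom ⊗ₘ (ρ_ b).hom) =
      (a ⊗ b) ◁ (λ_ (𝟙_ E)).hom ≫ (ρ_ (a ⊗ b)).hom := by
  rw [tensor_right_unitality, ← MonoidalCategory.whiskerLeft_comp_assoc, Iso.hom_inv_id,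
    MonoidalCategory.whiskerLeft_id, Category.id_comp]

theorem tensorμ_leftUnitor (a b : E) :
    tensorμ (𝟙_ E) (𝟙_ E) a b ≫ ((λ_ a).hom ⊗ₘ (λ_ b).hom) =
      (λ_ (𝟙_ E)).hom ▷ (a ⊗ b) ≫ (λ_ (a ⊗ b)).hom := by
  rw [tensor_left_unitality, ← comp_whiskerRight_assoc, Iso.hom_inv_id, id_whiskerRight,
    Category.id_comp]

theorem tensorμ_rightUnitor_leftUnitor (a b : E) :
    tensorμ a (𝟙_ E) (𝟙_ E) b ≫ ((ρ_ a).hom ⊗ₘ (λ_ b).hom) = (ρ_ a).hom ⊗ₘ (λ_ b).hom := by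
  have h : (β_ (𝟙_ E) (𝟙_ E)).hom = 𝟙 _ := by
    rw [braiding_tensorUnit_left, ← unitors_inv_equal, Iso.hom_inv_id]
  rw [tensorμ, h]
  monoidal

theorem tensorμ_braiding (W X Y Z : E) :
    tensorμ W X Y Z ≫ (β_ (W ⊗ Y) (X ⊗ Z)).hom =
      ((β_ W X).hom ⊗ₘ (β_ Y Z).hom) ≫ tensorμ X W Z Y := by
  simp [tensorμ, SymmetricCategory.braiding_swap_eq_inv_braiding X Y,
    MonoidalCategory.tensorHom_def]

section Coalgebra

variable {c : E} {Δ : c ⟶ c ⊗ c} {ε : c ⟶ 𝟙_ E}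

theorem tensorHom_whiskerRight_comul {a b M N d e : E} (p : a ⟶ M)
    (q : b ⟶ N) (u : M ⊗ c ⟶ d) (w : N ⊗ c ⟶ e) :
    (p ⊗ₘ q) ▷ c ≫ (M ⊗ N) ◁ Δ ≫ tensorμ M N c c ≫ (u ⊗ₘ w) =
      (a ⊗ b) ◁ Δ ≫ tensorμ a b c c ≫ ((p ▷ c ≫ u) ⊗ₘ (q ▷ c ≫ w)) := by
  rw [← whisker_exchange_assoc, ← tensorHom_comp_tensorHom, ← tensorHom_id p, ← tensorHom_id q,
    ← reassoc_of% (tensorμ_natural p q (𝟙 c) (𝟙 c)), id_tensorHom_id, tensorHom_id]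

theorem comul_tensorμ_rightUnitor (h : Δ ≫ (ε ⊗ₘ ε) = ε ≫ (λ_ (𝟙_ E)).inv) (a b : E) :
    (a ⊗ b) ◁ Δ ≫ tensorμ a b c c ≫ ((a ◁ ε ≫ (ρ_ a).hom) ⊗ₘ (b ◁ ε ≫ (ρ_ b).hom)) =
      (a ⊗ b) ◁ ε ≫ (ρ_ (a ⊗ b)).hom := by
  rw [← tensorHom_comp_tensorHom, ← id_tensorHom a, ← id_tensorHom b, ← tensorμ_natural_assoc,
    tensorμ_rightUnitor, id_tensorHom_id, id_tensorHom, ← MonoidalCategory.whiskerLeft_comp_assoc,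
    ← MonoidalCategory.whiskerLeft_comp_assoc, Category.assoc, reassoc_of% h, Iso.inv_hom_id,
    Category.comp_id]

/-- Cocommutativity absorbs the swap of the two copies of `c`; this yields the braiding
compatibility of the coend. -/
theorem comul_tensorμ_braiding (h : Δ ≫ (β_ c c).hom = Δ) {a b d e : E} (u : a ⊗ c ⟶ d)
    (w : b ⊗ c ⟶ e) :
    (a ⊗ b) ◁ Δ ≫ tensorμ a b c c ≫ (u ⊗ₘ w) ≫ (β_ d e).hom =
      (β_ a b).hom ▷ c ≫ (b ⊗ a) ◁ Δ ≫ tensorμ b a c c ≫ (w ⊗ₘ u) := by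
  rw [BraidedCategory.braiding_naturality, reassoc_of% (tensorμ_braiding a b c c),
    MonoidalCategory.tensorHom_def', Category.assoc, ← MonoidalCategory.whiskerLeft_comp_assoc, h,
    whisker_exchange_assoc]

theorem comul_tensorμ_leftUnitor {d e : E} (u : c ⟶ d) (w : c ⟶ e) :
    (𝟙_ E ⊗ 𝟙_ E) ◁ Δ ≫ tensorμ (𝟙_ E) (𝟙_ E) c c ≫
        (((λ_ c).hom ≫ u) ⊗ₘ ((λ_ c).hom ≫ w)) =
      (λ_ (𝟙_ E)).hom ▷ c ≫ (λ_ c).hom ≫ Δ ≫ (u ⊗ₘ w) := by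
  rw [← tensorHom_comp_tensorHom, reassoc_of% (tensorμ_leftUnitor c c), whisker_exchange_assoc,
    leftUnitor_naturality_assoc]

theorem comul_tensorμ_rightUnitor_leftUnitor (h : Δ ≫ ε ▷ c = (λ_ c).inv) (a : E) {d : E}
    (u : c ⟶ d) :
    (a ⊗ 𝟙_ E) ◁ Δ ≫ tensorμ a (𝟙_ E) c c ≫ ((a ◁ ε ≫ (ρ_ a).hom) ⊗ₘ ((λ_ c).hom ≫ u)) =
      (ρ_ a).hom ▷ c ≫ a ◁ u := by
  have h' : ((a ◁ ε ≫ (ρ_ a).hom) ⊗ₘ ((λ_ c).hom ≫ u)) =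
      ((𝟙 a ⊗ₘ ε) ⊗ₘ (𝟙 (𝟙_ E) ⊗ₘ 𝟙 c)) ≫ ((ρ_ a).hom ⊗ₘ (λ_ c).hom) ≫ a ◁ u := by
    rw [id_tensorHom_id, ← id_tensorHom, ← id_tensorHom, tensorHom_comp_tensorHom,
      tensorHom_comp_tensorHom, Category.id_comp, Category.comp_id]
  rw [h', ← tensorμ_natural_assoc, reassoc_of% (tensorμ_rightUnitor_leftUnitor a c),
    id_tensorHom_id, id_tensorHom, tensorHom_id, ← MonoidalCategory.whiskerLeft_comp_assoc, h,
    MonoidalCategory.tensorHom_def', Category.assoc, ← MonoidalCategory.whiskerLeft_comp_assoc,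
    Iso.inv_hom_id, MonoidalCategory.whiskerLeft_id, Category.id_comp]

end Coalgebra

end Interchange

/-! ### Comparing the coend on constants and on copowers -/

section CoendComparisons

open Functor.OplaxMonoidal

attribute [local instance] coendOplaxMonoidal

variable {G : Type v} [SmallCategory G]

/-- The morphism out of a corepresentable functor given by an element. -/
def element {X : G ⥤ Type v} {g : G} (x : X.obj g) : coyoneda.obj (Opposite.op g) ⟶ X where
  app k := ↾fun u => X.map u x
  naturality k l w := by
    ext u
    exact ConcreteCategory.congr_hom (X.map_comp u w) x

theorem element_comp {X Y : G ⥤ Type v} {g : G} (x : X.obj g) (f : X ⟶ Y) :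
    element x ≫ f = element (f.app g x) := by
  ext k u
  exact ConcreteCategory.congr_hom (f.naturality u) x

theorem coyoneda_map_element {X : G ⥤ Type v} {g g' : G} (f : g ⟶ g') (x : X.obj g) :
    coyoneda.map f.op ≫ element x = element (X.map f x) := by
  ext k u
  exact ConcreteCategory.congr_hom (X.map_comp f u) x

theorem element_coyoneda {g g' : G} (f : g ⟶ g') :
    element (X := coyoneda.obj (Opposite.op g)) f = coyoneda.map f.op := rfl

theorem diagonal_element {X Y : G ⥤ Type v} {g : G} (x : X.obj g) (y : Y.obj g) :
    diagonal _ ≫ (element x ⊗ₘ element y) = element (X := X ⊗ Y) (x, y) := rfl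

theorem element_unit {g : G} (x : (𝟙_ (G ⥤ Type v)).obj g) : element x = toPoint _ := rfl

variable {A : Type u} [Category.{v} A] [MonoidalCategory A] [SymmetricCategory A] [ComTwoRing A]
variable (F : (G ⥤ Type v) ⥤ A) [F.Braided]

theorem corepMap_corepCounit {g g' : G} (f : g ⟶ g') :
    corepMap F f ≫ corepCounit F g = corepCounit F g' := by
  rw [corepCounit, ← F.map_comp_assoc]
  rfl

/-- The diagonal is symmetric and `F` is braided. -/
theorem corepComul_braiding (g : G) :
    corepComul F g ≫ (β_ (corep F g) (corep F g)).hom = corepComul F g := by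
  rw [corepComul, Category.assoc, ← cancel_mono (Functor.LaxMonoidal.μ F _ _), Category.assoc,
    Category.assoc, Category.assoc, ← Functor.LaxBraided.braided, Functor.Monoidal.δ_μ_assoc,
    Functor.Monoidal.δ_μ, ← F.map_comp, Category.comp_id]
  rfl

theorem corepComul_corepCounit_whiskerRight (g : G) :
    corepComul F g ≫ corepCounit F g ▷ corep F g = (λ_ (corep F g)).inv := by
  rw [corepComul, corepCounit, Category.assoc, comp_whiskerRight, δ_natural_left_assoc,
    ← F.map_comp_assoc]
  exact (left_unitality F _).symm

theorem corepComul_corepCounit_tensor (g : G) :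
    corepComul F g ≫ (corepCounit F g ⊗ₘ corepCounit F g) =
      corepCounit F g ≫ (λ_ (𝟙_ A)).inv := by
  rw [MonoidalCategory.tensorHom_def, reassoc_of% (corepComul_corepCounit_whiskerRight F g),
    leftUnitor_inv_naturality]

theorem coendι_tensor (M N : G ⥤ A) (g : G) :
    coendι F (M ⊗ N) g ≫ δ (coendFunctor F) M N =
      (M.obj g ⊗ N.obj g) ◁ corepComul F g ≫ tensorμ _ _ _ _ ≫
        (coendι F M g ⊗ₘ coendι F N g) := by
  rw [coendι_δ, tensorδ_eq_tensorμ]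

theorem coendι_tensor_comp {M N : G ⥤ A} (g : G) {d e : A} (u : (coendFunctor F).obj M ⟶ d)
    (w : (coendFunctor F).obj N ⟶ e) :
    coendι F (M ⊗ N) g ≫ δ (coendFunctor F) M N ≫ (u ⊗ₘ w) =
      (M.obj g ⊗ N.obj g) ◁ corepComul F g ≫ tensorμ _ _ _ _ ≫
        ((coendι F M g ≫ u) ⊗ₘ (coendι F N g ≫ w)) := by
  rw [← tensorHom_comp_tensorHom]
  refine (Category.assoc _ _ _).symm.trans ((congrArg (· ≫ _) (coendι_tensor F M N g)).trans ?_)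
  exact (Category.assoc _ _ _).trans (congrArg _ (Category.assoc _ _ _))

theorem coend_braiding (M N : G ⥤ A) :
    (coendFunctor F).map (β_ M N).hom ≫ δ (coendFunctor F) N M =
      δ (coendFunctor F) M N ≫ (β_ _ _).hom := by
  refine coend_hom_ext fun g => ?_
  rw [← Category.assoc, coendι_map, ← Category.assoc, coendι_tensor]
  refine ((Category.assoc _ _ _).trans (congrArg _ (coendι_tensor F N M g))).trans ?_
  refine Eq.trans ?_ (Category.assoc _ _ _).symm
  refine Eq.trans ?_ (congrArg _ (Category.assoc _ _ _).symm)
  exact (comul_tensorμ_braiding (corepComul_braiding F g) _ _).symm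

theorem corepCounit_dinatural (a : A) {g g' : G} (f : g ⟶ g') :
    a ◁ corepMap F f ≫ a ◁ corepCounit F g ≫ (ρ_ a).hom =
      𝟙 a ▷ corep F g' ≫ a ◁ corepCounit F g' ≫ (ρ_ a).hom := by
  rw [← MonoidalCategory.whiskerLeft_comp_assoc, corepMap_corepCounit, id_whiskerRight,
    Category.id_comp]

/-- The comparison from the coend of a constant functor to its value. -/
def coendConst (a : A) : (coendFunctor F).obj ((Functor.const G).obj a) ⟶ a :=
  coendDesc (fun g => a ◁ corepCounit F g ≫ (ρ_ a).hom) (corepCounit_dinatural F a)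

theorem coendι_const (a : A) (g : G) :
    coendι F ((Functor.const G).obj a) g ≫ coendConst F a =
      a ◁ corepCounit F g ≫ (ρ_ a).hom :=
  coendι_desc (M := (Functor.const G).obj a) _ (corepCounit_dinatural F a) g

theorem coendConst_naturality {a b : A} (f : a ⟶ b) :
    (coendFunctor F).map ((Functor.const G).map f) ≫ coendConst F b = coendConst F a ≫ f :=
  coend_hom_ext fun g => by
    rw [reassoc_of% (coendι_map F ((Functor.const G).map f) g), coendι_const,
      reassoc_of% (coendι_const F a g)]
    exact (whisker_exchange_assoc f (corepCounit F g) (ρ_ b).hom).symm.trans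
      (congrArg _ (rightUnitor_naturality f))

theorem coendConst_unit : coendConst F (𝟙_ A) = η (coendFunctor F) :=
  coend_hom_ext fun g => (coendι_const F _ g).trans
    ((congrArg _ unitors_equal.symm).trans (coendι_η F g).symm)

theorem coendConst_tensor (a b : A) :
    δ (coendFunctor F) ((Functor.const G).obj a) ((Functor.const G).obj b) ≫
        (coendConst F a ⊗ₘ coendConst F b) =
      (coendFunctor F).map (Functor.LaxMonoidal.μ (Functor.const G) a b) ≫
        coendConst F (a ⊗ b) := by
  refine coend_hom_ext fun g => ?_
  rw [reassoc_of% (coendι_map F (Functor.LaxMonoidal.μ (Functor.const G) a b) g), coendι_const]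
  refine (coendι_tensor_comp F (M := (Functor.const G).obj a) (N := (Functor.const G).obj b) g
    (coendConst F a) (coendConst F b)).trans ?_
  rw [coendι_const, coendι_const]
  refine (comul_tensorμ_rightUnitor (corepComul_corepCounit_tensor F g) a b).trans ?_
  exact ((congrArg (· ≫ _) (id_whiskerRight _ _)).trans (Category.id_comp _)).symm

/-- The morphism from a copower by the value of a set-valued functor `X` at `g`, tensored with
the value of `F` at the functor corepresented by `g`, to the value of `F` at `X`. -/
def copowerValue (X : G ⥤ Type v) (g : G) :
    (copower A).obj (X.obj g) ⊗ corep F g ⟶ F.obj X :=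
  (β_ _ _).hom ≫ inclDesc fun x => F.map (element x)

theorem copower_whiskerRight_hom_ext {S : Type v} {a b : A} {m m' : (copower A).obj S ⊗ a ⟶ b}
    (h : ∀ s : S, point s ▷ a ≫ m = point s ▷ a ≫ m') : m = m' := by
  rw [← cancel_epi (β_ a _).hom]
  refine incl_hom_ext fun s => ?_
  simp only [incl, Category.assoc]
  rw [BraidedCategory.braiding_naturality_right_assoc,
    BraidedCategory.braiding_naturality_right_assoc, h]

theorem point_copowerValue (X : G ⥤ Type v) {g : G} (x : X.obj g) :
    point x ▷ corep F g ≫ copowerValue F X g = (λ_ (corep F g)).hom ≫ F.map (element x) := by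
  rw [copowerValue, BraidedCategory.braiding_naturality_left_assoc, braiding_tensorUnit_left,
    Category.assoc]
  exact congrArg _ ((Category.assoc _ _ _).symm.trans (incl_desc _ x))

theorem copowerValue_dinatural (X : G ⥤ Type v) {g g' : G} (f : g ⟶ g') :
    (copower A).obj (X.obj g) ◁ corepMap F f ≫ copowerValue F X g =
      (copower A).map (X.map f) ▷ corep F g' ≫ copowerValue F X g' := by
  refine copower_whiskerRight_hom_ext fun x => ?_
  rw [← whisker_exchange_assoc, point_copowerValue, leftUnitor_naturality_assoc, ← F.map_comp,
    coyoneda_map_element, ← comp_whiskerRight_assoc, point_map, point_copowerValue]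

/-- The comparison from the coend of the copowers of a set-valued functor. -/
def coendCopower (X : G ⥤ Type v) :
    (coendFunctor F).obj ((functorCopower G A).obj X) ⟶ F.obj X :=
  coendDesc (fun g => copowerValue F X g) (copowerValue_dinatural F X)

theorem coendι_copower (X : G ⥤ Type v) (g : G) :
    coendι F ((functorCopower G A).obj X) g ≫ coendCopower F X = copowerValue F X g :=
  coendι_desc (M := (functorCopower G A).obj X) _ (copowerValue_dinatural F X) g

theorem coendCopower_naturality {X Y : G ⥤ Type v} (f : X ⟶ Y) :
    (coendFunctor F).map ((functorCopower G A).map f) ≫ coendCopower F Y =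
      coendCopower F X ≫ F.map f := by
  refine coend_hom_ext fun g => copower_whiskerRight_hom_ext fun x => ?_
  rw [reassoc_of% (coendι_map F ((functorCopower G A).map f) g), coendι_copower,
    reassoc_of% (coendι_copower F X g), reassoc_of% (point_copowerValue F X x), ← F.map_comp,
    element_comp]
  dsimp
  rw [← comp_whiskerRight_assoc, point_map, point_copowerValue]

theorem coendCopower_unit :
    coendCopower F (𝟙_ (G ⥤ Type v)) ≫ η F =
      (coendFunctor F).map (η (functorCopower G A)) ≫ η (coendFunctor F) := by
  refine coend_hom_ext fun g => copower_whiskerRight_hom_ext fun x => ?_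
  rw [reassoc_of% (coendι_copower F (𝟙_ (G ⥤ Type v)) g),
    reassoc_of% (point_copowerValue F (𝟙_ (G ⥤ Type v)) x),
    reassoc_of% (coendι_map F (η (functorCopower G A)) g), coendι_η, element_unit]
  have h := congrArg (fun k => k ▷ corep F g ≫ 𝟙_ A ◁ corepCounit F g ≫ (λ_ (𝟙_ A)).hom)
    (point_η (A := A) x)
  refine Eq.trans ?_ (h.symm.trans (comp_whiskerRight_assoc _ _ _ _))
  rw [id_whiskerRight, Category.id_comp, leftUnitor_naturality]
  rfl

/-- The map classifying `(x, y)` is the diagonal followed by those classifying `x` and `y`, which is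
the role of `corepComul`. -/
theorem point_copowerValue_tensor {X Y : G ⥤ Type v} {g : G} (x : X.obj g) (y : Y.obj g) :
    (point (x, y) ≫ δ (copower A) (X.obj g) (Y.obj g)) ▷ corep F g ≫
        (((copower A).obj (X.obj g) ⊗ (copower A).obj (Y.obj g)) ◁ corepComul F g ≫
          tensorμ _ _ _ _ ≫ (copowerValue F X g ⊗ₘ copowerValue F Y g)) =
      (λ_ (corep F g)).hom ≫ F.map (element (X := X ⊗ Y) (x, y)) ≫ δ F X Y := by
  rw [point_δ, comp_whiskerRight_assoc, tensorHom_whiskerRight_comul, point_copowerValue,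
    point_copowerValue, comul_tensorμ_leftUnitor, ← comp_whiskerRight_assoc, Iso.inv_hom_id,
    id_whiskerRight, Category.id_comp, ← diagonal_element, F.map_comp, Category.assoc,
    ← δ_natural, corepComul, Category.assoc]

theorem coendCopower_tensor (X Y : G ⥤ Type v) :
    coendCopower F (X ⊗ Y) ≫ δ F X Y =
      (coendFunctor F).map (δ (functorCopower G A) X Y) ≫ δ (coendFunctor F) _ _ ≫
        (coendCopower F X ⊗ₘ coendCopower F Y) := by
  refine coend_hom_ext fun g => copower_whiskerRight_hom_ext fun x => ?_
  obtain ⟨x, y⟩ := x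
  rw [reassoc_of% (coendι_copower F (X ⊗ Y) g),
    reassoc_of% (point_copowerValue F (X ⊗ Y) (x, y)),
    reassoc_of% (coendι_map F (δ (functorCopower G A) X Y) g)]
  refine (point_copowerValue_tensor F x y).symm.trans ?_
  rw [comp_whiskerRight, Category.assoc]
  refine congrArg _ (congrArg _ ?_)
  refine Eq.trans ?_ (coendι_tensor_comp F (M := (functorCopower G A).obj X)
    (N := (functorCopower G A).obj Y) g (coendCopower F X) (coendCopower F Y)).symm
  rw [coendι_copower, coendι_copower]
  rfl

end CoendComparisons


/-! ### Invertibility of the comparisons -/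

section CoendIso

open Functor.OplaxMonoidal

attribute [local instance] coendOplaxMonoidal

variable {G : Type v} [SmallCategory G]
variable {A : Type u} [Category.{v} A] [MonoidalCategory A] [SymmetricCategory A] [ComTwoRing A]
variable (F : (G ⥤ Type v) ⥤ A) [F.Braided]

/-- The comparison from the coend of the tensor product of a constant functor and the copowers of
a set-valued functor. -/
def coendComparison (a : A) (X : G ⥤ Type v) :
    (coendFunctor F).obj ((Functor.const G).obj a ⊗ (functorCopower G A).obj X) ⟶ a ⊗ F.obj X :=
  δ (coendFunctor F) _ _ ≫ (coendConst F a ⊗ₘ coendCopower F X)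

/-- The morphism to the coend at an element of the set-valued functor. -/
def coendIncl (a : A) {X : G ⥤ Type v} {g : G} (x : X.obj g) :
    a ⊗ corep F g ⟶
      (coendFunctor F).obj ((Functor.const G).obj a ⊗ (functorCopower G A).obj X) :=
  incl a x ▷ corep F g ≫ coendι F ((Functor.const G).obj a ⊗ (functorCopower G A).obj X) g

/-- Comultiplication doubles `corep F g`; the constant factor discards one copy by the counit, and
`x` acts on the other. -/
theorem coendIncl_comparison (a : A) {X : G ⥤ Type v} {g : G} (x : X.obj g) :
    coendIncl F a x ≫ coendComparison F a X = a ◁ F.map (element x) := by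
  have h : (a ⊗ (copower A).obj (X.obj g)) ◁ corepComul F g ≫ tensorμ _ _ _ _ ≫
      ((a ◁ corepCounit F g ≫ (ρ_ a).hom) ⊗ₘ copowerValue F X g) =
      coendι F ((Functor.const G).obj a ⊗ (functorCopower G A).obj X) g ≫
        coendComparison F a X := by
    rw [← coendι_const, ← coendι_copower]
    exact (coendι_tensor_comp F (M := (Functor.const G).obj a)
      (N := (functorCopower G A).obj X) g (coendConst F a) (coendCopower F X)).symm
  refine (Category.assoc _ _ _).trans ((congrArg _ h.symm).trans ?_)
  rw [incl, comp_whiskerRight, ← id_tensorHom, Category.assoc, tensorHom_whiskerRight_comul,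
    point_copowerValue, id_whiskerRight, Category.id_comp,
    comul_tensorμ_rightUnitor_leftUnitor (corepComul_corepCounit_whiskerRight F g),
    ← comp_whiskerRight_assoc, Iso.inv_hom_id, id_whiskerRight, Category.id_comp]

theorem incl_whiskerRight_hom_ext {a b c : A} {S : Type v} {m m' : (a ⊗ (copower A).obj S) ⊗ c ⟶ b}
    (h : ∀ s : S, incl a s ▷ c ≫ m = incl a s ▷ c ≫ m') : m = m' := by
  apply (cancel_epi (β_ c (a ⊗ (copower A).obj S)).hom).1
  apply (cancel_epi (α_ c a ((copower A).obj S)).hom).1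
  refine incl_hom_ext fun s => ?_
  have hs : incl (c ⊗ a) s ≫ (α_ c a ((copower A).obj S)).hom = c ◁ incl a s := by
    simp [incl]
  rw [reassoc_of% hs, reassoc_of% hs, BraidedCategory.braiding_naturality_right_assoc,
    BraidedCategory.braiding_naturality_right_assoc, h]

theorem coendIncl_hom_ext {a b : A} {X : G ⥤ Type v}
    {m m' : (coendFunctor F).obj ((Functor.const G).obj a ⊗ (functorCopower G A).obj X) ⟶ b}
    (h : ∀ (g : G) (x : X.obj g), coendIncl F a x ≫ m = coendIncl F a x ≫ m') : m = m' :=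
  coend_hom_ext fun g => incl_whiskerRight_hom_ext fun x =>
    (Category.assoc _ _ _).symm.trans ((h g x).trans (Category.assoc _ _ _))

/-- Dinaturality trades the action of `f` on `corep F` for its action on elements. -/
theorem corepMap_coendIncl (a : A) {X : G ⥤ Type v} {g g' : G} (f : g ⟶ g') (x : X.obj g) :
    a ◁ corepMap F f ≫ coendIncl F a x = coendIncl F a (X.map f x) := by
  have h := coendι_dinatural F ((Functor.const G).obj a ⊗ (functorCopower G A).obj X) f
  refine (whisker_exchange_assoc (incl a x) (corepMap F f)
    (coendι F ((Functor.const G).obj a ⊗ (functorCopower G A).obj X) g)).trans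
      ((congrArg (incl a x ▷ corep F g' ≫ ·) h).trans ?_)
  refine (Category.assoc _ _ _).symm.trans (congrArg (· ≫ _) ?_)
  refine (comp_whiskerRight _ _ _).symm.trans (congrArg (· ▷ corep F g') ?_)
  refine Eq.trans ?_ (incl_map a x (X.map f))
  exact congrArg _ (id_tensorHom _ _)

/-- Co-Yoneda: every element of a corepresentable functor is the image of `𝟙 g`, so inclusion at `𝟙
g` is the inverse. -/
instance coendComparison_coyoneda_isIso (a : A) (g : G) :
    IsIso (coendComparison F a (coyoneda.obj (Opposite.op g))) := by
  refine ⟨coendIncl F a (X := coyoneda.obj (Opposite.op g)) (𝟙 g), coendIncl_hom_ext F ?_, ?_⟩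
  · intro k f
    rw [← Category.assoc, coendIncl_comparison, Category.comp_id]
    refine (corepMap_coendIncl F a f (X := coyoneda.obj (Opposite.op g)) (𝟙 g)).trans ?_
    exact congrArg (coendIncl F a (X := coyoneda.obj (Opposite.op g))) (Category.id_comp f)
  · rw [coendIncl_comparison, element_coyoneda]
    simp

variable [PreservesColimitsOfSize.{v, v} F]

instance preservesColimits_functorCopower :
    PreservesColimitsOfSize.{v, v} (functorCopower G A) :=
  ((copowerAdj A).whiskerRight G).leftAdjoint_preservesColimits

/-- Both sides are cocontinuous in `X`, so the corepresentable case suffices. -/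
theorem coendComparison_isIso (a : A) (X : G ⥤ Type v) : IsIso (coendComparison F a X) := by
  refine prop_of_coyoneda (fun X => IsIso (coendComparison F a X)) (fun J _ => ?_)
    (fun g => coendComparison_coyoneda_isIso F a g) X
  exact isClosedUnderColimits_isIso_app
    (F := functorCopower G A ⋙ tensorLeft ((Functor.const G).obj a) ⋙ coendFunctor F)
    (F' := F ⋙ tensorLeft a)
    { app X := coendComparison F a X
      naturality X Y f := by
        change (coendFunctor F).map ((Functor.const G).obj a ◁ (functorCopower G A).map f) ≫
          coendComparison F a Y = coendComparison F a X ≫ a ◁ F.map f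
        rw [coendComparison, coendComparison, ← δ_natural_right_assoc, ← id_tensorHom,
          ← id_tensorHom, tensorHom_comp_tensorHom, coendCopower_naturality, Category.assoc,
          tensorHom_comp_tensorHom, Category.id_comp, Category.comp_id] } J

/-- The case `a = 𝟙_ A` of the comparison, by oplax unitality; the next instance takes `X` to be the
unit instead. -/
instance coendCopower_isIso (X : G ⥤ Type v) : IsIso (coendCopower F X) := by
  have h : coendComparison F (𝟙_ A) X = (coendFunctor F).map (λ_ _).hom ≫
      coendCopower F X ≫ (λ_ _).inv := by
    rw [coendComparison, coendConst_unit, leftUnitor_inv_naturality]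
    exact δ_comp_η_tensorHom _ _
  have := coendComparison_isIso F (𝟙_ A) X
  have h1 := IsIso.of_isIso_fac_left h.symm
  exact IsIso.of_isIso_comp_right _ (λ_ (F.obj X)).inv

instance coendConst_isIso (a : A) : IsIso (coendConst F a) := by
  have h : coendComparison F a (𝟙_ (G ⥤ Type v)) ≫ a ◁ η F =
      (coendFunctor F).map (((Functor.const G).obj a) ◁ η (functorCopower G A)) ≫
        (coendFunctor F).map (ρ_ _).hom ≫ coendConst F a ≫ (ρ_ a).inv := by
    rw [coendComparison, Category.assoc, ← id_tensorHom, tensorHom_comp_tensorHom,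
      coendCopower_unit, Category.comp_id, rightUnitor_inv_naturality]
    refine Eq.trans ?_ (congrArg _ (δ_comp_tensorHom_η (F := coendFunctor F) (coendConst F a)))
    rw [← δ_natural_right_assoc, ← id_tensorHom, tensorHom_comp_tensorHom, Category.id_comp]
  have := coendComparison_isIso F a (𝟙_ (G ⥤ Type v))
  have h1 := IsIso.of_isIso_fac_left h.symm
  have h2 := IsIso.of_isIso_comp_left ((coendFunctor F).map (ρ_ ((Functor.const G).obj a)).hom)
    (coendConst F a ≫ (ρ_ a).inv)
  exact IsIso.of_isIso_comp_right _ (ρ_ a).inv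

instance coend_η_isIso : IsIso (η (coendFunctor F)) := by
  rw [← coendConst_unit]
  infer_instance

/-- Associativity follows from the oplax associativity square by cancelling isomorphisms. -/
theorem coend_δ_tensorRelation :
    TensorRelation fun M N => IsIso (δ (coendFunctor F) M N) where
  symm {M N} h := by
    exact IsIso.of_isIso_fac_left (coend_braiding F M N)
  congr_left {M M' N} e h := by
    exact IsIso.of_isIso_fac_left (δ_natural_left (coendFunctor F) e.hom N).symm
  assoc {M N P} hMN hNP := by
    have h := associativity (coendFunctor F) M N P
    constructor
    · intro h1
      have h2 := IsIso.of_isIso_fac_left h.symm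
      exact IsIso.of_isIso_comp_right _ ((coendFunctor F).obj M ◁ δ (coendFunctor F) N P)
    · intro h1
      exact IsIso.of_isIso_fac_right h

theorem coend_δ_isIso (M N : G ⥤ A) : IsIso (δ (coendFunctor F) M N) := by
  refine (coend_δ_tensorRelation F).of_generators (fun N J _ => ?_) (fun a b => ?_) (fun X Y => ?_)
    (fun a X => ?_) M N
  · exact isClosedUnderColimits_isIso_app (F := tensorRight N ⋙ coendFunctor F)
      (F' := coendFunctor F ⋙ tensorRight ((coendFunctor F).obj N))
      { app M := δ (coendFunctor F) M N
        naturality M M' f := (δ_natural_left (coendFunctor F) f N).symm } J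
  · have h := coendConst_tensor F a b
    have h1 : IsIso ((coendFunctor F).map (Functor.LaxMonoidal.μ (Functor.const G) a b) ≫
      coendConst F (a ⊗ b)) := inferInstance
    rw [← h] at h1
    exact IsIso.of_isIso_comp_right _ (coendConst F a ⊗ₘ coendConst F b)
  · have h := coendCopower_tensor F X Y
    have h1 : IsIso (coendCopower F (X ⊗ Y) ≫ δ F X Y) := inferInstance
    rw [h] at h1
    have h2 := IsIso.of_isIso_comp_left
      ((coendFunctor F).map (δ (functorCopower G A) X Y))
      (δ (coendFunctor F) _ _ ≫ (coendCopower F X ⊗ₘ coendCopower F Y))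
    exact IsIso.of_isIso_comp_right _ (coendCopower F X ⊗ₘ coendCopower F Y)
  · have := coendComparison_isIso F a X
    unfold coendComparison at this
    exact IsIso.of_isIso_comp_right _ (coendConst F a ⊗ₘ coendCopower F X)

instance (M N : G ⥤ A) : IsIso (δ (coendFunctor F) M N) := coend_δ_isIso F M N

instance : (coendFunctor F).Monoidal := Functor.Monoidal.ofOplaxMonoidal _

end CoendIso


section IsoOfNatIso

variable {B : Type u₁} [Category.{v} B] [MonoidalCategory B]
variable {C : Type u₂} [Category.{v} C] [MonoidalCategory C]

open Functor.OplaxMonoidal in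
theorem isMonoidal_of_oplaxMonoidal {P Q : B ⥤ C} [P.Monoidal] [Q.Monoidal] (τ : P ⟶ Q)
    (hη : τ.app (𝟙_ B) ≫ η Q = η P)
    (hδ : ∀ X Y, τ.app (X ⊗ Y) ≫ δ Q X Y = δ P X Y ≫ (τ.app X ⊗ₘ τ.app Y)) :
    NatTrans.IsMonoidal τ where
  unit := by
    rw [← cancel_mono (η Q), Category.assoc, hη, Functor.Monoidal.ε_η, Functor.Monoidal.ε_η]
  tensor X Y := by
    rw [← cancel_mono (δ Q X Y), Category.assoc, Category.assoc, hδ, Functor.Monoidal.μ_δ_assoc,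
      Functor.Monoidal.μ_δ, Category.comp_id]

variable [SymmetricCategory B] [ComTwoRing B] [SymmetricCategory C] [ComTwoRing C]

/-- An invertible 2-morphism from a monoidal natural isomorphism. -/
def Hom.isoOfNatIso {f g : Hom B C} (τ : f.left ≅ g.left) (h : NatTrans.IsMonoidal τ.hom) :
    f ≅ g where
  hom := ⟨τ.hom, h⟩
  inv := ⟨τ.inv, inferInstance⟩
  hom_inv_id := Hom.Trans.ext τ.hom_inv_id
  inv_hom_id := Hom.Trans.ext τ.inv_hom_id

end IsoOfNatIso

/-! ### Essential surjectivity -/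

section EssSurj

open Functor.OplaxMonoidal

variable {G : Type v} [SmallCategory G]
variable {A : Type u} [Category.{v} A] [MonoidalCategory A] [SymmetricCategory A] [ComTwoRing A]
variable (F : (G ⥤ Type v) ⥤ A) [F.Braided] [PreservesColimitsOfSize.{v, v} F]

instance : (coendFunctor F).Braided where
  braided M N := by
    rw [← cancel_epi (δ (coendFunctor F) M N), Functor.Monoidal.δ_μ_assoc,
      ← cancel_mono (δ (coendFunctor F) N M), Category.assoc, Category.assoc,
      Functor.Monoidal.μ_δ, Category.comp_id]
    exact coend_braiding F M N

variable [ComTwoRing (G ⥤ A)]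

/-- The coend functor as a 1-morphism of commutative 2-rings. -/
def coendHom : Hom (G ⥤ A) A :=
  have : IsLocallyPresentable.{v} (G ⥤ A) := ComTwoRing.presentable
  have : (coendFunctor F).IsLeftAdjoint := isLeftAdjoint_of_isLocallyPresentable _
  { left := coendFunctor F
    right := (coendFunctor F).rightAdjoint
    adj := Adjunction.ofIsLeftAdjoint _
    braided := inferInstance }

/-- The natural isomorphism given by the coends of constant functors. -/
def coendConstIso : Functor.const G ⋙ coendFunctor F ≅ 𝟭 A :=
  NatIso.ofComponents (fun a => @asIso _ _ _ _ (coendConst F a) (coendConst_isIso F a)) fun f =>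
    coendConst_naturality F f

/-- The natural isomorphism given by the coends of copowers. -/
def coendCopowerIso : functorCopower G A ⋙ coendFunctor F ≅ F :=
  NatIso.ofComponents (fun X => @asIso _ _ _ _ (coendCopower F X) (coendCopower_isIso F X)) fun f =>
    coendCopower_naturality F f

theorem coendConstIso_isMonoidal : NatTrans.IsMonoidal (coendConstIso F).hom := by
  refine isMonoidal_of_oplaxMonoidal _ ?_ fun a b => ?_
  · refine Eq.trans ?_ (comp_η (Functor.const G) (coendFunctor F)).symm
    have h : (coendFunctor F).map (η (Functor.const G)) = 𝟙 _ :=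
      (coendFunctor F).map_id (𝟙_ (G ⥤ A))
    rw [h]
    exact (Category.comp_id _).trans ((coendConst_unit F).trans (Category.id_comp _).symm)
  · refine Eq.trans ?_ (congrArg (· ≫ _) (comp_δ (Functor.const G) (coendFunctor F) a b).symm)
    refine Eq.trans ?_ (Category.assoc _ _ _).symm
    refine Eq.trans ?_ (congrArg ((coendFunctor F).map (δ (Functor.const G) a b) ≫ ·)
      (coendConst_tensor F a b).symm)
    refine (Category.comp_id _).trans ?_
    rw [← Functor.map_comp_assoc, Functor.Monoidal.δ_μ]
    exact ((congrArg (· ≫ _) (CategoryTheory.Functor.map_id _ _)).trans (Category.id_comp _)).symm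

theorem coendCopowerIso_isMonoidal : NatTrans.IsMonoidal (coendCopowerIso F).hom := by
  refine isMonoidal_of_oplaxMonoidal _ ?_ fun X Y => ?_
  · exact (coendCopower_unit F).trans (comp_η (functorCopower G A) (coendFunctor F)).symm
  · refine (coendCopower_tensor F X Y).trans ?_
    exact (Category.assoc _ _ _).symm.trans
      (congrArg (· ≫ _) (comp_δ (functorCopower G A) (coendFunctor F) X Y).symm)

instance {L : (G ⥤ A) ⥤ A} (adj : (Functor.const G : A ⥤ G ⥤ A) ⊣ L) :
    (restriction adj).EssSurj where
  mem_essImage f := by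
    -- The coend of `f.left` is the preimage: its values on constants give `ζ`, those on copowers
    -- give back `f`.
    refine ⟨⟨coendHom f.left, (Hom.isoOfNatIso (f := (constAlgebra G A adj).comp (coendHom f.left))
      (g := Hom.idHom A) (coendConstIso f.left) (coendConstIso_isMonoidal f.left)).symm⟩, ⟨?_⟩⟩
    exact Hom.isoOfNatIso (f := (copowerHom G A).comp (coendHom f.left)) (g := f)
      (coendCopowerIso f.left) (coendCopowerIso_isMonoidal f.left)

instance {L : (G ⥤ A) ⥤ A} (adj : (Functor.const G : A ⥤ G ⥤ A) ⊣ L) :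
    (restriction adj).IsEquivalence where

end EssSurj

end ComTwoRing

end

theorem mainTheorem11 (G : Type v) [SmallCategory G] (A : Type u) [Category.{v} A]
    [MonoidalCategory A] [SymmetricCategory A] [ComTwoRing A] :
    ∃ (_ : ComTwoRing (G ⥤ A)) (L : (G ⥤ A) ⥤ A) (adj : (Functor.const G : A ⥤ G ⥤ A) ⊣ L),
      Nonempty (ComTwoRing.TannakaKrein G A adj ≌ ComTwoRing.Hom (G ⥤ Type v) A) := by
  have := ComTwoRing.isLeftAdjoint_const A G
  let adj := Adjunction.ofIsLeftAdjoint (Functor.const G : A ⥤ G ⥤ A)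
  have := ComTwoRing.functorCategory A G
  exact ⟨this, _, adj, ⟨(ComTwoRing.restriction adj).asEquivalence⟩⟩
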